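/- Fix an alphabet $\Sigma$ (finite or infinite). **Automata.** A lo-set $U$ is a finite totally ordered set labelled by $\Sigma$; a lo-set with interfaces (ilo-set) is a lo-set $U$ with subsets $S_U,T_U\subseteq U$. A coface map $d_{A,B}:U\to V$ of lo-sets consists of an order- and label-preserving injection $U\hookrightarrow V$ and a partition of the complement of its image into two sets $A$ and $B$ (the events unstarted, respectively terminated, in $U$); composition is $d_{C,D}\circ d_{A,B}=d_{g(A)\cup C,\,g(B)\cup D}$, where $g$ is the injection of $d_{C,D}$. For ilo-sets one requires in addition $A\cap S_V=\emptyset=B\cap T_V$ and that $S_U,T_U$ are the preimages of $S_V,T_V$. Up to isomorphism of objects this gives small categories $\square$ and $\mathrm{I}\square$. A *higher-dimensional automaton* (HDA) is a presheaf $X$ on $\square$ with finitely many cells (elements of the sets $X[U]$) and with sets $X_\bot$ of start cells and $X^\top$ of accept cells; an HDA with interfaces (iHDA) is likewise a presheaf on $\mathrm{I}\square$ with finitely many cells and sets of start and accept cells such that $S_U=U$ for start cells in $X[U]$ and $T_U=U$ for accept cells in $X[U]$. **Ipomsets.** A labelled iposet $P$ is a finite $\Sigma$-labelled set with two strict partial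 orders $<$ (precedence) and $\dashrightarrow$ (event order) such that any two distinct elements are comparable by at least one of them, and with subsets $S_P$ of $<$-minimal and $T_P$ of $<$-maximal elements (interfaces). A subsumption $P\to Q$ is a label-preserving bijection $f$ with $f(S_P)=S_Q$ and $f(T_P)=T_Q$ such that $f(x)<f(y)$ implies $x<y$, and such that $x\dashrightarrow y$ with $x,y$ $<$-incomparable implies $f(x)\dashrightarrow f(y)$; it is an isomorphism if moreover $x<y$ implies $f(x)<f(y)$. An ipomset is an isomorphism class of labelled iposets; $P\sqsubseteq Q$ means that there is a subsumption $P\to Q$. $P$ is interval if there are $b,e:P\to\mathbb{R}$ with $b\le e$ and $x<y\iff e(x)<b(y)$. If $T_P\cong S_Q$ as lo-sets, $P*Q$ is the disjoint union of $P$ and $Q$ with $T_P$ and $S_Q$ identified along the unique isomorphism, with $S_{P*Q}=S_P$, $T_{P*Q}=T_Q$, event order the transitive closure of those of $P$ and $Q$, and $x<y$ iff $x<_Py$ or $x<_Qy$ or ($x\in P\setminus T_P$ and $y\in Q\setminus S_Q$). **Languages.** A language is a set $L$ of interval ipomsets such that $Q\in L$, $P\sqsubseteq Q$ and $P$ interval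 imply $P\in L$. Put $L*M=\{R \text{ interval}\mid R\sqsubseteq P*Q \text{ for some } P\in L,\ Q\in M \text{ with } T_P\cong S_Q\}$, $L^1=L$, $L^{n+1}=L*L^n$ and $L^+=\bigcup_{n\ge1}L^n$. $L$ is *separated* if every $P\in L$ has an element outside $S_P\cup T_P$. **Recognition.** A path in an HDA or iHDA is a finite sequence of cells, each consecutive pair $(x,y)$ of which is either an up-step, $x=X[d_{A,\emptyset}](y)$, or a down-step, $y=X[d_{\emptyset,B}](x)$. Its ipomset is the gluing composition of the ipomsets of its steps, an up-step to a cell with events $U$ contributing the discrete ipomset $U$ with interfaces $(U\setminus A,U)$, a down-step from a cell with events $U$ contributing the discrete ipomset $U$ with interfaces $(U,U\setminus B)$, and a path of length $0$ at a cell with events $U$ having the ipomset $U$ with interfaces $(U,U)$. The language of an HDA or iHDA is the set of ipomsets of its paths from a start cell to an accept cell. A language is *regular* if it is recognised by an HDA or by an iHDA. **Proposition.** Let $L$ be a separated language that is regular, that is, the language of an HDA or of an iHDA. Then the Kleene plus $L^+$ is regular; more precisely, it is the language of an HDA, and also the language of an iHDA. -/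

import Mathlib

open CategoryTheory Opposite

namespace HigherDim

universe u v w w'

/-! ### Lo-sets, ilo-sets and the labelled precube categories

The objects of the (skeletal) precube categories are words; the lo-set of a word of length `n` is
`Fin n` with its usual order (the event order) and the labelling given by the letters. -/

/-- A lo-set up to isomorphism, that is, a word over the alphabet `Act`. -/
structure LoSet (Act : Type u) where
  n : ℕ
  lab : Fin n → Act

/-- A lo-set with a source interface `S` and a target interface `T`, up to isomorphism. -/
structure ILoSet (Act : Type u) extends LoSet Act where
  S : Set (Fin n)
  T : Set (Fin n)

variable {Act : Type u}

/-- The coface map `d_{A,B} : U → V`: it inserts the events of `A` (which are unstarted in `U`)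
and of `B` (which are terminated in `U`). -/
@[ext]
structure Coface (U V : LoSet Act) where
  emb : Fin U.n ↪o Fin V.n
  A : Set (Fin V.n)
  B : Set (Fin V.n)
  lab : ∀ i, V.lab (emb i) = U.lab i
  disj : Disjoint A B
  union : A ∪ B = (Set.range emb)ᶜ

/-- Coface maps of ilo-sets: events of the source interface of `V` cannot be unstarted, those of the
target interface cannot be terminated, and the interfaces of `U` are the preimages of those of
`V`. -/
@[ext]
structure ICoface (U V : ILoSet Act) extends Coface U.toLoSet V.toLoSet where
  A_S : Disjoint A V.S
  B_T : Disjoint B V.T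
  S_eq : U.S = emb ⁻¹' V.S
  T_eq : U.T = emb ⁻¹' V.T

namespace Coface

/-- The identity coface map `d_{∅,∅}`. -/
def id (U : LoSet Act) : Coface U U where
  emb := RelEmbedding.refl _
  A := ∅
  B := ∅
  lab _ := rfl
  disj := by simp
  union := by
    ext i
    simp

/-- The composite `d_{C,D} ∘ d_{A,B}`, in diagrammatic order. -/
def comp {U V W : LoSet Act} (d : Coface U V) (e : Coface V W) : Coface U W where
  emb := d.emb.trans e.emb
  A := e.emb '' d.A ∪ e.A
  B := e.emb '' d.B ∪ e.B
  lab i := by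
    rw [RelEmbedding.trans_apply, e.lab, d.lab]
  disj := by
    have hA : e.A ⊆ (Set.range e.emb)ᶜ := e.union ▸ Set.subset_union_left
    have hB : e.B ⊆ (Set.range e.emb)ᶜ := e.union ▸ Set.subset_union_right
    rw [Set.disjoint_left]
    rintro x (⟨a, ha, rfl⟩ | hx) (⟨b, hb, hab⟩ | hx')
    · rw [e.emb.injective hab] at hb
      exact Set.disjoint_left.1 d.disj ha hb
    · exact hB hx' ⟨a, rfl⟩
    · exact hA hx ⟨b, hab⟩
    · exact Set.disjoint_left.1 e.disj hx hx'
  union := by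
    have he : ∀ x, (x ∈ e.A ∨ x ∈ e.B) ↔ ¬ ∃ y, e.emb y = x := fun x => by
      have h := Set.ext_iff.1 e.union x
      simpa using h
    have hd : ∀ x, (x ∈ d.A ∨ x ∈ d.B) ↔ ¬ ∃ y, d.emb y = x := fun x => by
      have h := Set.ext_iff.1 d.union x
      simpa using h
    ext x
    simp only [Set.mem_union, Set.mem_image, Set.mem_compl_iff, Set.mem_range,
      RelEmbedding.trans_apply]
    constructor
    · rintro ((⟨a, ha, rfl⟩ | h) | (⟨a, ha, rfl⟩ | h)) ⟨y, hy⟩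
      · exact (hd a).1 (Or.inl ha) ⟨y, e.emb.injective hy⟩
      · exact (he x).1 (Or.inl h) ⟨_, hy⟩
      · exact (hd a).1 (Or.inr ha) ⟨y, e.emb.injective hy⟩
      · exact (he x).1 (Or.inr h) ⟨_, hy⟩
    · intro h
      by_cases hx : ∃ y, e.emb y = x
      · obtain ⟨y, rfl⟩ := hx
        have : ¬ ∃ z, d.emb z = y := by
          rintro ⟨z, rfl⟩
          exact h ⟨z, rfl⟩
        rcases (hd y).2 this with h1 | h1
        · exact Or.inl (Or.inl ⟨y, h1, rfl⟩)
        · exact Or.inr (Or.inl ⟨y, h1, rfl⟩)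
      · rcases (he x).2 hx with h1 | h1
        · exact Or.inl (Or.inr h1)
        · exact Or.inr (Or.inr h1)

end Coface

namespace ICoface

/-- The identity coface map of an ilo-set. -/
def id (U : ILoSet Act) : ICoface U U where
  toCoface := Coface.id U.toLoSet
  A_S := Set.disjoint_left.2 fun _ h => h.elim
  B_T := Set.disjoint_left.2 fun _ h => h.elim
  S_eq := rfl
  T_eq := rfl

/-- Composition of coface maps of ilo-sets, in diagrammatic order. -/
def comp {U V W : ILoSet Act} (d : ICoface U V) (e : ICoface V W) : ICoface U W where
  toCoface := d.toCoface.comp e.toCoface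
  A_S := by
    rw [Set.disjoint_left]
    rintro x (⟨a, ha, rfl⟩ | hx) h
    · refine Set.disjoint_left.1 d.A_S ha ?_
      rw [e.S_eq]
      exact h
    · exact Set.disjoint_left.1 e.A_S hx h
  B_T := by
    rw [Set.disjoint_left]
    rintro x (⟨a, ha, rfl⟩ | hx) h
    · refine Set.disjoint_left.1 d.B_T ha ?_
      rw [e.T_eq]
      exact h
    · exact Set.disjoint_left.1 e.B_T hx h
  S_eq := by
    rw [d.S_eq, e.S_eq]
    rfl
  T_eq := by
    rw [d.T_eq, e.T_eq]
    rfl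

end ICoface

theorem Coface.id_comp {U V : LoSet Act} (f : Coface U V) : (Coface.id U).comp f = f := by
  apply Coface.ext
  · rfl
  · simp [Coface.comp, Coface.id]
  · simp [Coface.comp, Coface.id]

theorem Coface.comp_id {U V : LoSet Act} (f : Coface U V) : f.comp (Coface.id V) = f := by
  apply Coface.ext
  · rfl
  · simp [Coface.comp, Coface.id]
  · simp [Coface.comp, Coface.id]

theorem Coface.assoc {U V W Z : LoSet Act} (f : Coface U V) (g : Coface V W) (h : Coface W Z) :
    (f.comp g).comp h = f.comp (g.comp h) := by
  apply Coface.ext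
  · rfl
  · simp [Coface.comp, Set.image_union, Set.image_image, Set.union_assoc]
  · simp [Coface.comp, Set.image_union, Set.image_image, Set.union_assoc]

/-- The labelled precube category. -/
instance : Category.{0} (LoSet Act) where
  Hom := Coface
  id := Coface.id
  comp := Coface.comp
  id_comp := Coface.id_comp
  comp_id := Coface.comp_id
  assoc := Coface.assoc

theorem ICoface.toCoface_injective {U V : ILoSet Act} :
    Function.Injective (ICoface.toCoface : ICoface U V → Coface U.toLoSet V.toLoSet) := by
  rintro ⟨d, _, _, _, _⟩ ⟨e, _, _, _, _⟩ h
  cases h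
  rfl

/-- The labelled precube category with interfaces. -/
instance : Category.{0} (ILoSet Act) where
  Hom := ICoface
  id := ICoface.id
  comp := ICoface.comp
  id_comp f := ICoface.toCoface_injective (Coface.id_comp f.toCoface)
  comp_id f := ICoface.toCoface_injective (Coface.comp_id f.toCoface)
  assoc f g h := ICoface.toCoface_injective (Coface.assoc f.toCoface g.toCoface h.toCoface)

/-- The functor forgetting interfaces. -/
def forgetInterfaces (Act : Type u) : ILoSet Act ⥤ LoSet Act where
  obj U := U.toLoSet
  map f := ICoface.toCoface f
  map_id _ := rfl
  map_comp _ _ := rfl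

/-! ### Labelled iposets and ipomsets -/

/-- A labelled iposet `(P, <, ⇢, S, T, λ)`; `prec` is the precedence order `<` and `evo` the event
order `⇢`. -/
structure IPoset (Act : Type u) where
  carrier : Type
  finite : Finite carrier
  prec : carrier → carrier → Prop
  evo : carrier → carrier → Prop
  S : Set carrier
  T : Set carrier
  lab : carrier → Act
  prec_irrefl : ∀ x, ¬ prec x x
  prec_trans : ∀ x y z, prec x y → prec y z → prec x z
  evo_irrefl : ∀ x, ¬ evo x x
  evo_trans : ∀ x y z, evo x y → evo y z → evo x z
  comparable : ∀ x y, x = y ∨ prec x y ∨ prec y x ∨ evo x y ∨ evo y x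
  S_minimal : ∀ x ∈ S, ∀ y, ¬ prec y x
  T_maximal : ∀ x ∈ T, ∀ y, ¬ prec x y

namespace IPoset

/-- A subsumption `P → Q`. -/
structure Subsumption (P Q : IPoset Act) where
  toEquiv : P.carrier ≃ Q.carrier
  map_S : toEquiv '' P.S = Q.S
  map_T : toEquiv '' P.T = Q.T
  map_lab : ∀ x, Q.lab (toEquiv x) = P.lab x
  reflect_prec : ∀ x y, Q.prec (toEquiv x) (toEquiv y) → P.prec x y
  map_evo : ∀ x y, P.evo x y → ¬ P.prec x y → ¬ P.prec y x → Q.evo (toEquiv x) (toEquiv y)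

/-- An isomorphism: a subsumption that is an isomorphism of precedence orders. (The event order is
only relevant between elements that are incomparable for the precedence order.) -/
structure Iso (P Q : IPoset Act) extends Subsumption P Q where
  map_prec : ∀ x y, P.prec x y → Q.prec (toEquiv x) (toEquiv y)

/-- The identity subsumption. -/
def Subsumption.refl (P : IPoset Act) : Subsumption P P where
  toEquiv := Equiv.refl _
  map_S := by simp
  map_T := by simp
  map_lab _ := rfl
  reflect_prec _ _ h := h
  map_evo _ _ h _ _ := h

/-- Composition of subsumptions. -/
def Subsumption.trans {P Q R : IPoset Act} (f : Subsumption P Q) (g : Subsumption Q R) :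
    Subsumption P R where
  toEquiv := f.toEquiv.trans g.toEquiv
  map_S := by
    rw [← g.map_S, ← f.map_S, Set.image_image]
    rfl
  map_T := by
    rw [← g.map_T, ← f.map_T, Set.image_image]
    rfl
  map_lab x := (g.map_lab _).trans (f.map_lab x)
  reflect_prec x y h := f.reflect_prec x y (g.reflect_prec _ _ h)
  map_evo x y h h1 h2 := g.map_evo _ _ (f.map_evo x y h h1 h2)
    (fun h3 => h1 (f.reflect_prec _ _ h3)) (fun h3 => h2 (f.reflect_prec _ _ h3))

/-- The inverse of an isomorphism. -/
def Iso.symm {P Q : IPoset Act} (f : Iso P Q) : Iso Q P where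
  toEquiv := f.toEquiv.symm
  map_S := by
    rw [← f.map_S, Equiv.symm_image_image]
  map_T := by
    rw [← f.map_T, Equiv.symm_image_image]
  map_lab x := by
    rw [← f.map_lab, Equiv.apply_symm_apply]
  reflect_prec x y h := by
    have := f.map_prec _ _ h
    rwa [Equiv.apply_symm_apply, Equiv.apply_symm_apply] at this
  map_prec x y h := by
    apply f.reflect_prec
    rwa [Equiv.apply_symm_apply, Equiv.apply_symm_apply]
  map_evo x y h h1 h2 := by
    obtain ⟨x, rfl⟩ := f.toEquiv.surjective x
    obtain ⟨y, rfl⟩ := f.toEquiv.surjective y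
    rw [Equiv.symm_apply_apply, Equiv.symm_apply_apply]
    have h1' : ¬ P.prec x y := fun h' => h1 (f.map_prec _ _ h')
    have h2' : ¬ P.prec y x := fun h' => h2 (f.map_prec _ _ h')
    rcases P.comparable x y with rfl | h3 | h3 | h3 | h3
    · exact absurd h (Q.evo_irrefl _)
    · exact absurd h3 h1'
    · exact absurd h3 h2'
    · exact h3
    · exact absurd (Q.evo_trans _ _ _ h (f.map_evo _ _ h3 h2' h1')) (Q.evo_irrefl _)

/-- Isomorphism of labelled iposets as a setoid. -/
instance setoid (Act : Type u) : Setoid (IPoset Act) where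
  r P Q := Nonempty (Iso P Q)
  iseqv :=
    { refl := fun P => ⟨{ Subsumption.refl P with map_prec := fun _ _ h => h }⟩
      symm := fun ⟨f⟩ => ⟨f.symm⟩
      trans := fun ⟨f⟩ ⟨g⟩ => ⟨{ f.toSubsumption.trans g.toSubsumption with
        map_prec := fun x y h => g.map_prec _ _ (f.map_prec x y h) }⟩ }

/-- `P` admits an interval representation. -/
def IsInterval (P : IPoset Act) : Prop :=
  ∃ b e : P.carrier → ℝ, (∀ x, b x ≤ e x) ∧ ∀ x y, P.prec x y ↔ e x < b y

/-- `P` is separated: some element lies in no interface. -/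
def IsSeparated (P : IPoset Act) : Prop :=
  (Set.univ \ (P.S ∪ P.T)).Nonempty

/-- An isomorphism of lo-sets from the target interface of `P` to the source interface of `Q`. -/
structure InterfaceIso (P Q : IPoset Act) where
  toEquiv : P.T ≃ Q.S
  evo_iff : ∀ x y : P.T, P.evo x y ↔ Q.evo (toEquiv x) (toEquiv y)
  lab_eq : ∀ x : P.T, Q.lab (toEquiv x) = P.lab x

section Glue

variable (P Q : IPoset Act) (f : InterfaceIso P Q)

/-- The carrier of the gluing composition: the disjoint union of `P` and `Q` with `x ∈ T_P`
identified with `f x ∈ S_Q`, represented as the disjoint union of `P` and `Q \ S_Q`. -/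
abbrev GlueCarrier : Type := P.carrier ⊕ {q : Q.carrier // q ∉ Q.S}

variable {P Q}

/-- The structural inclusion of the left factor. -/
def glueLeft (x : P.carrier) : GlueCarrier P Q := Sum.inl x

open Classical in
/-- The structural inclusion of the right factor. -/
noncomputable def glueRight (y : Q.carrier) : GlueCarrier P Q :=
  if h : y ∈ Q.S then Sum.inl (f.toEquiv.symm ⟨y, h⟩ : P.T).1 else Sum.inr ⟨y, h⟩

/-- The precedence order of the gluing composition. -/
def gluePrec (a b : GlueCarrier P Q) : Prop :=
  (∃ x y, a = glueLeft x ∧ b = glueLeft y ∧ P.prec x y) ∨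
  (∃ x y, a = glueRight f x ∧ b = glueRight f y ∧ Q.prec x y) ∨
  (∃ x y, a = glueLeft x ∧ b = glueRight f y ∧ x ∉ P.T ∧ y ∉ Q.S)

/-- The union of the event orders of the factors. -/
def glueEvoStep (a b : GlueCarrier P Q) : Prop :=
  (∃ x y, a = glueLeft x ∧ b = glueLeft y ∧ P.evo x y) ∨
  (∃ x y, a = glueRight f x ∧ b = glueRight f y ∧ Q.evo x y)

variable {f}

theorem glueLeft_inj {x y : P.carrier} :
    (glueLeft x : GlueCarrier P Q) = glueLeft y ↔ x = y := by
  simp [glueLeft]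

theorem glueLeft_eq_glueRight {x : P.carrier} {y : Q.carrier} :
    glueLeft x = glueRight f y ↔ ∃ t : P.T, x = t ∧ y = f.toEquiv t := by
  unfold glueLeft glueRight
  split_ifs with h
  · constructor
    · intro hx
      exact ⟨f.toEquiv.symm ⟨y, h⟩, Sum.inl.inj hx, by simp⟩
    · rintro ⟨t, rfl, rfl⟩
      simp
  · constructor
    · intro hx
      cases hx
    · rintro ⟨t, rfl, rfl⟩
      exact absurd (f.toEquiv t).2 h

theorem glueRight_inj {x y : Q.carrier} : glueRight f x = glueRight f y ↔ x = y := by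
  constructor
  · intro h
    by_cases hx : x ∈ Q.S
    · have h1 : glueLeft (f.toEquiv.symm ⟨x, hx⟩ : P.T).1 = glueRight f x :=
        glueLeft_eq_glueRight.2 ⟨_, rfl, by simp⟩
      rw [h, glueLeft_eq_glueRight] at h1
      obtain ⟨t, h2, rfl⟩ := h1
      rw [← Subtype.ext h2]
      simp
    · by_cases hy : y ∈ Q.S
      · simp [glueRight, hx, hy] at h
      · simpa [glueRight, hx, hy] using h
  · rintro rfl
    rfl

theorem exists_glueLeft_or_glueRight (a : GlueCarrier P Q) :
    (∃ x, a = glueLeft x) ∨ (∃ y, y ∉ Q.S ∧ a = glueRight f y) := by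
  rcases a with x | ⟨y, hy⟩
  · exact Or.inl ⟨x, rfl⟩
  · exact Or.inr ⟨y, hy, by simp [glueRight, hy]⟩

theorem glueEvo_cases {a b : GlueCarrier P Q} (h : Relation.TransGen (glueEvoStep f) a b) :
    (∃ x y, a = glueLeft x ∧ b = glueLeft y ∧ P.evo x y) ∨
    (∃ x y, a = glueRight f x ∧ b = glueRight f y ∧ Q.evo x y) ∨
    (∃ (x : P.carrier) (t : P.T) (y : Q.carrier), a = glueLeft x ∧ b = glueRight f y ∧
      P.evo x t ∧ Q.evo (f.toEquiv t) y) ∨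
    (∃ (x : Q.carrier) (t : P.T) (y : P.carrier), a = glueRight f x ∧ b = glueLeft y ∧
      Q.evo x (f.toEquiv t) ∧ P.evo t y) := by
  induction h with
  | single h =>
    rcases h with h | h
    · exact Or.inl h
    · exact Or.inr (Or.inl h)
  | tail _ h ih =>
    rcases ih with ⟨x, y, rfl, rfl, hxy⟩ | ⟨x, y, rfl, rfl, hxy⟩ | ⟨x, t, y, rfl, rfl, h1, h2⟩ |
        ⟨x, t, y, rfl, rfl, h1, h2⟩ <;>
      rcases h with ⟨y', z, hy, rfl, h3⟩ | ⟨y', z, hy, rfl, h3⟩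
    · rw [glueLeft_inj] at hy
      subst hy
      exact Or.inl ⟨x, z, rfl, rfl, P.evo_trans _ _ _ hxy h3⟩
    · obtain ⟨t, rfl, rfl⟩ := glueLeft_eq_glueRight.1 hy
      exact Or.inr (Or.inr (Or.inl ⟨x, t, z, rfl, rfl, hxy, h3⟩))
    · obtain ⟨t, rfl, rfl⟩ := glueLeft_eq_glueRight.1 hy.symm
      exact Or.inr (Or.inr (Or.inr ⟨x, t, z, rfl, rfl, hxy, h3⟩))
    · rw [glueRight_inj] at hy
      subst hy
      exact Or.inr (Or.inl ⟨x, z, rfl, rfl, Q.evo_trans _ _ _ hxy h3⟩)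
    · obtain ⟨s, rfl, rfl⟩ := glueLeft_eq_glueRight.1 hy.symm
      exact Or.inl ⟨x, z, rfl, rfl, P.evo_trans _ _ _ h1
        (P.evo_trans _ _ _ ((f.evo_iff _ _).2 h2) h3)⟩
    · rw [glueRight_inj] at hy
      subst hy
      exact Or.inr (Or.inr (Or.inl ⟨x, t, z, rfl, rfl, h1, Q.evo_trans _ _ _ h2 h3⟩))
    · rw [glueLeft_inj] at hy
      subst hy
      exact Or.inr (Or.inr (Or.inr ⟨x, t, z, rfl, rfl, h1, P.evo_trans _ _ _ h2 h3⟩))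
    · obtain ⟨s, rfl, rfl⟩ := glueLeft_eq_glueRight.1 hy
      exact Or.inr (Or.inl ⟨x, z, rfl, rfl, Q.evo_trans _ _ _ h1
        (Q.evo_trans _ _ _ ((f.evo_iff _ _).1 h2) h3)⟩)

theorem glueEvo_irrefl (a : GlueCarrier P Q) : ¬ Relation.TransGen (glueEvoStep f) a a := by
  intro h
  rcases glueEvo_cases h with ⟨x, y, rfl, h0, hxy⟩ | ⟨x, y, rfl, h0, hxy⟩ |
    ⟨x, t, y, rfl, h0, h1, h2⟩ | ⟨x, t, y, rfl, h0, h1, h2⟩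
  · rw [glueLeft_inj] at h0
    subst h0
    exact P.evo_irrefl _ hxy
  · rw [glueRight_inj] at h0
    subst h0
    exact Q.evo_irrefl _ hxy
  · obtain ⟨s, rfl, rfl⟩ := glueLeft_eq_glueRight.1 h0
    exact P.evo_irrefl _ (P.evo_trans _ _ _ h1 ((f.evo_iff _ _).2 h2))
  · obtain ⟨s, rfl, rfl⟩ := glueLeft_eq_glueRight.1 h0.symm
    exact P.evo_irrefl _ (P.evo_trans _ _ _ h2 ((f.evo_iff _ _).2 h1))

theorem gluePrec_irrefl (a : GlueCarrier P Q) : ¬ gluePrec f a a := by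
  rintro (⟨x, y, rfl, h0, h⟩ | ⟨x, y, rfl, h0, h⟩ | ⟨x, y, rfl, h0, h1, h2⟩)
  · rw [glueLeft_inj] at h0
    subst h0
    exact P.prec_irrefl _ h
  · rw [glueRight_inj] at h0
    subst h0
    exact Q.prec_irrefl _ h
  · obtain ⟨s, rfl, rfl⟩ := glueLeft_eq_glueRight.1 h0
    exact h1 s.2

theorem gluePrec_trans {a b c : GlueCarrier P Q} (h : gluePrec f a b) (h' : gluePrec f b c) :
    gluePrec f a c := by
  rcases h with ⟨x, y, rfl, rfl, h⟩ | ⟨x, y, rfl, rfl, h⟩ | ⟨x, y, rfl, rfl, h1, h2⟩ <;>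
    rcases h' with ⟨y', z, hy, rfl, h'⟩ | ⟨y', z, hy, rfl, h'⟩ | ⟨y', z, hy, rfl, h1', h2'⟩
  · rw [glueLeft_inj] at hy
    subst hy
    exact Or.inl ⟨x, z, rfl, rfl, P.prec_trans _ _ _ h h'⟩
  · obtain ⟨t, rfl, rfl⟩ := glueLeft_eq_glueRight.1 hy
    exact Or.inr (Or.inr ⟨x, z, rfl, rfl, fun hx => P.T_maximal _ hx _ h,
      fun hz => Q.S_minimal _ hz _ h'⟩)
  · exact Or.inr (Or.inr ⟨x, z, rfl, rfl, fun hx => P.T_maximal _ hx _ h, h2'⟩)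
  · obtain ⟨t, rfl, rfl⟩ := glueLeft_eq_glueRight.1 hy.symm
    exact absurd h' (P.T_maximal _ t.2 _)
  · rw [glueRight_inj] at hy
    subst hy
    exact Or.inr (Or.inl ⟨x, z, rfl, rfl, Q.prec_trans _ _ _ h h'⟩)
  · obtain ⟨t, rfl, rfl⟩ := glueLeft_eq_glueRight.1 hy.symm
    exact absurd t.2 h1'
  · obtain ⟨t, rfl, rfl⟩ := glueLeft_eq_glueRight.1 hy.symm
    exact absurd (f.toEquiv t).2 h2
  · rw [glueRight_inj] at hy
    subst hy
    exact Or.inr (Or.inr ⟨x, z, rfl, rfl, h1, fun hz => Q.S_minimal _ hz _ h'⟩)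
  · obtain ⟨t, rfl, rfl⟩ := glueLeft_eq_glueRight.1 hy.symm
    exact absurd t.2 h1'

theorem glue_comparable_mixed (x : P.carrier) (y : Q.carrier) (hy : y ∉ Q.S) :
    gluePrec f (glueLeft x) (glueRight f y) ∨
    gluePrec f (glueRight f y) (glueLeft x) ∨
    Relation.TransGen (glueEvoStep f) (glueLeft x) (glueRight f y) ∨
    Relation.TransGen (glueEvoStep f) (glueRight f y) (glueLeft x) := by
  by_cases hx : x ∈ P.T
  · have hx' : glueLeft x = glueRight f (f.toEquiv ⟨x, hx⟩ : Q.S).1 :=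
      glueLeft_eq_glueRight.2 ⟨⟨x, hx⟩, rfl, rfl⟩
    rw [hx']
    rcases Q.comparable (f.toEquiv ⟨x, hx⟩ : Q.S).1 y with h | h | h | h | h
    · exact absurd (h ▸ (f.toEquiv ⟨x, hx⟩ : Q.S).2) hy
    · exact Or.inl (Or.inr (Or.inl ⟨_, _, rfl, rfl, h⟩))
    · exact Or.inr (Or.inl (Or.inr (Or.inl ⟨_, _, rfl, rfl, h⟩)))
    · exact Or.inr (Or.inr (Or.inl (.single (Or.inr ⟨_, _, rfl, rfl, h⟩))))
    · exact Or.inr (Or.inr (Or.inr (.single (Or.inr ⟨_, _, rfl, rfl, h⟩))))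
  · exact Or.inl (Or.inr (Or.inr ⟨x, y, rfl, rfl, hx, hy⟩))

theorem glue_comparable (a b : GlueCarrier P Q) :
    a = b ∨ gluePrec f a b ∨ gluePrec f b a ∨
      Relation.TransGen (glueEvoStep f) a b ∨ Relation.TransGen (glueEvoStep f) b a := by
  rcases exists_glueLeft_or_glueRight (f := f) a with ⟨x, rfl⟩ | ⟨x, hx, rfl⟩ <;>
    rcases exists_glueLeft_or_glueRight (f := f) b with ⟨y, rfl⟩ | ⟨y, hy, rfl⟩
  · rcases P.comparable x y with rfl | h | h | h | h
    · exact Or.inl rfl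
    · exact Or.inr (Or.inl (Or.inl ⟨_, _, rfl, rfl, h⟩))
    · exact Or.inr (Or.inr (Or.inl (Or.inl ⟨_, _, rfl, rfl, h⟩)))
    · exact Or.inr (Or.inr (Or.inr (Or.inl (.single (Or.inl ⟨_, _, rfl, rfl, h⟩)))))
    · exact Or.inr (Or.inr (Or.inr (Or.inr (.single (Or.inl ⟨_, _, rfl, rfl, h⟩)))))
  · exact Or.inr (glue_comparable_mixed x y hy)
  · have := glue_comparable_mixed (f := f) y x hx
    tauto
  · rcases Q.comparable x y with rfl | h | h | h | h
    · exact Or.inl rfl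
    · exact Or.inr (Or.inl (Or.inr (Or.inl ⟨_, _, rfl, rfl, h⟩)))
    · exact Or.inr (Or.inr (Or.inl (Or.inr (Or.inl ⟨_, _, rfl, rfl, h⟩))))
    · exact Or.inr (Or.inr (Or.inr (Or.inl (.single (Or.inr ⟨_, _, rfl, rfl, h⟩)))))
    · exact Or.inr (Or.inr (Or.inr (Or.inr (.single (Or.inr ⟨_, _, rfl, rfl, h⟩)))))

theorem glue_S_minimal (s : P.carrier) (hs : s ∈ P.S) (b : GlueCarrier P Q) :
    ¬ gluePrec f b (glueLeft s) := by
  rintro (⟨x, y, rfl, h0, h⟩ | ⟨x, y, rfl, h0, h⟩ | ⟨x, y, rfl, h0, h1, h2⟩)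
  · rw [glueLeft_inj] at h0
    subst h0
    exact P.S_minimal _ hs _ h
  · obtain ⟨t, rfl, rfl⟩ := glueLeft_eq_glueRight.1 h0
    exact Q.S_minimal _ (f.toEquiv t).2 _ h
  · obtain ⟨t, rfl, rfl⟩ := glueLeft_eq_glueRight.1 h0
    exact h2 (f.toEquiv t).2

theorem glue_T_maximal (s : Q.carrier) (hs : s ∈ Q.T) (b : GlueCarrier P Q) :
    ¬ gluePrec f (glueRight f s) b := by
  rintro (⟨x, y, h0, rfl, h⟩ | ⟨x, y, h0, rfl, h⟩ | ⟨x, y, h0, rfl, h1, h2⟩)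
  · obtain ⟨t, rfl, rfl⟩ := glueLeft_eq_glueRight.1 h0.symm
    exact P.T_maximal _ t.2 _ h
  · rw [glueRight_inj] at h0
    subst h0
    exact Q.T_maximal _ hs _ h
  · obtain ⟨t, rfl, rfl⟩ := glueLeft_eq_glueRight.1 h0.symm
    exact h1 t.2

variable (P Q f)

/-- The gluing composition `P * Q` along an isomorphism `f : T_P ≅ S_Q` (which is unique if it
exists). -/
noncomputable def glue : IPoset Act where
  carrier := GlueCarrier P Q
  finite := by
    have := P.finite
    have := Q.finite
    infer_instance
  prec := gluePrec f
  evo := Relation.TransGen (glueEvoStep f)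
  S := glueLeft '' P.S
  T := glueRight f '' Q.T
  lab := Sum.elim P.lab (fun q => Q.lab q.1)
  prec_irrefl := gluePrec_irrefl
  prec_trans _ _ _ := gluePrec_trans
  evo_irrefl := glueEvo_irrefl
  evo_trans _ _ _ := Relation.TransGen.trans
  comparable := glue_comparable
  S_minimal := by
    rintro _ ⟨s, hs, rfl⟩ b
    exact glue_S_minimal s hs b
  T_maximal := by
    rintro _ ⟨s, hs, rfl⟩ b
    exact glue_T_maximal s hs b

end Glue

/-- The discrete iposet of a lo-set `U` with interfaces `S` and `T`. -/
def discrete (U : LoSet Act) (S T : Set (Fin U.n)) : IPoset Act where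
  carrier := Fin U.n
  finite := inferInstance
  prec _ _ := False
  evo i j := i < j
  S := S
  T := T
  lab := U.lab
  prec_irrefl _ h := h
  prec_trans _ _ _ h _ := h
  evo_irrefl := lt_irrefl
  evo_trans _ _ _ := lt_trans
  comparable x y := by
    rcases lt_trichotomy x y with h | h | h <;> tauto
  S_minimal _ _ _ h := h
  T_maximal _ _ _ h := h

end IPoset

/-- Ipomsets: isomorphism classes of labelled iposets. -/
def Ipomset (Act : Type u) := Quotient (IPoset.setoid Act)

namespace Ipomset

/-- The isomorphism class of a labelled iposet. -/
def mk (P : IPoset Act) : Ipomset Act := Quotient.mk _ P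

/-- The subsumption relation `P ⊑ Q` on ipomsets. -/
def Subsumed : Ipomset Act → Ipomset Act → Prop :=
  Quotient.lift₂ (fun P Q => Nonempty (IPoset.Subsumption P Q)) (by
    rintro P Q P' Q' ⟨f⟩ ⟨g⟩
    exact propext ⟨fun ⟨h⟩ => ⟨(f.symm.toSubsumption.trans h).trans g.toSubsumption⟩,
      fun ⟨h⟩ => ⟨(f.toSubsumption.trans h).trans g.symm.toSubsumption⟩⟩)

theorem Subsumed.trans {P Q R : Ipomset Act} (h : Subsumed P Q) (h' : Subsumed Q R) :
    Subsumed P R := by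
  induction P using Quotient.ind
  induction Q using Quotient.ind
  induction R using Quotient.ind
  obtain ⟨f⟩ := h
  obtain ⟨g⟩ := h'
  exact ⟨f.trans g⟩

theorem isInterval_of_iso {P Q : IPoset Act} (f : IPoset.Iso P Q) (h : P.IsInterval) :
    Q.IsInterval := by
  obtain ⟨b, e, hbe, h⟩ := h
  refine ⟨b ∘ f.toEquiv.symm, e ∘ f.toEquiv.symm, fun x => hbe _, fun x y => ?_⟩
  rw [Function.comp_apply, Function.comp_apply, ← h]
  exact ⟨fun h' => f.symm.map_prec _ _ h', fun h' => f.symm.reflect_prec _ _ h'⟩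

/-- Interval ipomsets. -/
def IsInterval : Ipomset Act → Prop :=
  Quotient.lift IPoset.IsInterval (by
    rintro P Q ⟨f⟩
    exact propext ⟨isInterval_of_iso f, isInterval_of_iso f.symm⟩)

theorem isSeparated_of_iso {P Q : IPoset Act} (f : IPoset.Iso P Q) (h : P.IsSeparated) :
    Q.IsSeparated := by
  obtain ⟨x, -, hx⟩ := h
  refine ⟨f.toEquiv x, trivial, ?_⟩
  rw [← f.map_S, ← f.map_T]
  simpa using hx

/-- Separated ipomsets. -/
def IsSeparated : Ipomset Act → Prop :=
  Quotient.lift IPoset.IsSeparated (by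
    rintro P Q ⟨f⟩
    exact propext ⟨isSeparated_of_iso f, isSeparated_of_iso f.symm⟩)

/-- The down-closure of a set of ipomsets, inside the set of interval ipomsets. -/
def downClosure (M : Set (Ipomset Act)) : Set (Ipomset Act) :=
  {P | P.IsInterval ∧ ∃ Q ∈ M, Subsumed P Q}

/-- The set of all `P * Q` with `P ∈ L`, `Q ∈ M` and `T_P ≅ S_Q`. -/
def glueSet (L M : Set (Ipomset Act)) : Set (Ipomset Act) :=
  {R | ∃ (P Q : IPoset Act) (f : IPoset.InterfaceIso P Q),
    mk P ∈ L ∧ mk Q ∈ M ∧ R = mk (IPoset.glue P Q f)}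

end Ipomset

/-! ### Languages -/

/-- An (interval ipomset) language: a set of interval ipomsets that is down-closed within the
interval ipomsets. -/
@[ext]
structure IpomsetLanguage (Act : Type u) where
  carrier : Set (Ipomset Act)
  interval : ∀ P ∈ carrier, P.IsInterval
  down_closed : ∀ P Q : Ipomset Act, P.IsInterval → P.Subsumed Q → Q ∈ carrier → P ∈ carrier

namespace IpomsetLanguage

/-- Gluing composition `L * M` of languages. -/
def glue (L M : IpomsetLanguage Act) : IpomsetLanguage Act where
  carrier := Ipomset.downClosure (Ipomset.glueSet L.carrier M.carrier)
  interval _ h := h.1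
  down_closed := by
    rintro P Q hP hPQ ⟨-, R, hR, hQR⟩
    exact ⟨hP, R, hR, hPQ.trans hQR⟩

/-- `L.powSucc n` is the power `L ^ (n + 1)`, where `L ^ 1 = L` and `L ^ (n + 1) = L * L ^ n`. -/
def powSucc (L : IpomsetLanguage Act) : ℕ → IpomsetLanguage Act
  | 0 => L
  | n + 1 => L.glue (L.powSucc n)

/-- The Kleene plus, the union of all powers `L ^ n` with `n ≥ 1`. -/
def kleenePlus (L : IpomsetLanguage Act) : IpomsetLanguage Act where
  carrier := ⋃ n : ℕ, (L.powSucc n).carrier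
  interval P h := by
    obtain ⟨n, hn⟩ := Set.mem_iUnion.1 h
    exact (L.powSucc n).interval P hn
  down_closed P Q hP hPQ h := by
    obtain ⟨n, hn⟩ := Set.mem_iUnion.1 h
    exact Set.mem_iUnion.2 ⟨n, (L.powSucc n).down_closed P Q hP hPQ hn⟩

/-- A language is separated if all its elements are. -/
def IsSeparated (L : IpomsetLanguage Act) : Prop :=
  ∀ P ∈ L.carrier, P.IsSeparated

end IpomsetLanguage

/-! ### Paths and their ipomsets -/

/-- A labelled iposet together with isomorphisms of its source interface with the lo-set `U` and of
its target interface with the lo-set `V`. -/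
structure IPosetArrow (U V : LoSet Act) where
  P : IPoset Act
  src : Fin U.n ≃ P.S
  src_evo : ∀ i j, i < j ↔ P.evo (src i) (src j)
  src_lab : ∀ i, P.lab (src i) = U.lab i
  tgt : Fin V.n ≃ P.T
  tgt_evo : ∀ i j, i < j ↔ P.evo (tgt i) (tgt j)
  tgt_lab : ∀ i, P.lab (tgt i) = V.lab i

namespace IPosetArrow

/-- The identity ipomset of `U`, with `S = U = T`. -/
def id (U : LoSet Act) : IPosetArrow U U where
  P := IPoset.discrete U Set.univ Set.univ
  src := (Equiv.Set.univ _).symm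
  src_evo _ _ := Iff.rfl
  src_lab _ := rfl
  tgt := (Equiv.Set.univ _).symm
  tgt_evo _ _ := Iff.rfl
  tgt_lab _ := rfl

/-- The ipomset of an up-step along `d : U → V` (which starts the events of `V \ U`): the carrier
is `V`, the source interface is `U` and the target interface is `V`. -/
noncomputable def starter {U V : LoSet Act} (d : Coface U V) : IPosetArrow U V where
  P := IPoset.discrete V (Set.range d.emb) Set.univ
  src := Equiv.ofInjective d.emb d.emb.injective
  src_evo _ _ := d.emb.lt_iff_lt.symm
  src_lab := d.lab
  tgt := (Equiv.Set.univ _).symm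
  tgt_evo _ _ := Iff.rfl
  tgt_lab _ := rfl

/-- The ipomset of a down-step along `d : V → U` (which terminates the events of `U \ V`): the
carrier is `U`, the source interface is `U` and the target interface is `V`. -/
noncomputable def terminator {U V : LoSet Act} (d : Coface V U) : IPosetArrow U V where
  P := IPoset.discrete U Set.univ (Set.range d.emb)
  src := (Equiv.Set.univ _).symm
  src_evo _ _ := Iff.rfl
  src_lab _ := rfl
  tgt := Equiv.ofInjective d.emb d.emb.injective
  tgt_evo _ _ := d.emb.lt_iff_lt.symm
  tgt_lab := d.lab

/-- The isomorphism along which two composable arrows are glued. -/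
def interfaceIso {U V W : LoSet Act} (p : IPosetArrow U V) (q : IPosetArrow V W) :
    IPoset.InterfaceIso p.P q.P where
  toEquiv := p.tgt.symm.trans q.src
  evo_iff x y := by
    obtain ⟨i, rfl⟩ := p.tgt.surjective x
    obtain ⟨j, rfl⟩ := p.tgt.surjective y
    simp only [Equiv.trans_apply, Equiv.symm_apply_apply]
    rw [← p.tgt_evo, ← q.src_evo]
  lab_eq x := by
    obtain ⟨i, rfl⟩ := p.tgt.surjective x
    simp only [Equiv.trans_apply, Equiv.symm_apply_apply]
    rw [q.src_lab, p.tgt_lab]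

/-- Gluing composition of composable arrows. -/
noncomputable def comp {U V W : LoSet Act} (p : IPosetArrow U V) (q : IPosetArrow V W) :
    IPosetArrow U W where
  P := IPoset.glue p.P q.P (p.interfaceIso q)
  src := p.src.trans (Equiv.Set.image _ p.P.S (fun _ _ h => IPoset.glueLeft_inj.1 h))
  src_evo i j := by
    rw [p.src_evo]
    constructor
    · intro h
      exact .single (Or.inl ⟨_, _, rfl, rfl, h⟩)
    · intro h
      by_contra h'
      rw [← p.src_evo, not_lt] at h'
      rcases h'.eq_or_lt with rfl | h'
      · exact IPoset.glueEvo_irrefl _ h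
      · rw [p.src_evo] at h'
        exact IPoset.glueEvo_irrefl _ (h.trans (.single (Or.inl ⟨_, _, rfl, rfl, h'⟩)))
  src_lab i := p.src_lab i
  tgt := q.tgt.trans (Equiv.Set.image _ q.P.T (fun _ _ h => IPoset.glueRight_inj.1 h))
  tgt_evo i j := by
    rw [q.tgt_evo]
    constructor
    · intro h
      exact .single (Or.inr ⟨_, _, rfl, rfl, h⟩)
    · intro h
      by_contra h'
      rw [← q.tgt_evo, not_lt] at h'
      rcases h'.eq_or_lt with rfl | h'
      · exact IPoset.glueEvo_irrefl _ h
      · rw [q.tgt_evo] at h'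
        exact IPoset.glueEvo_irrefl _ (h.trans (.single (Or.inr ⟨_, _, rfl, rfl, h'⟩)))
  tgt_lab i := by
    rw [← q.tgt_lab i]
    change Sum.elim p.P.lab (fun q' => q.P.lab q'.1)
      (IPoset.glueRight (p.interfaceIso q) (q.tgt i).1) = _
    unfold IPoset.glueRight
    split_ifs with h
    · have := (p.interfaceIso q).lab_eq ((p.interfaceIso q).toEquiv.symm ⟨_, h⟩)
      rw [Equiv.apply_symm_apply] at this
      exact this.symm
    · rfl

end IPosetArrow

/-- Paths in a presheaf `X` on a category `C` over the labelled precube category: `C` is the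
labelled precube category itself for precubical sets and the labelled precube category with
interfaces for ipc-sets. A path is a sequence of up-steps `δ⁰_A(y) → y` and down-steps
`x → δ¹_B(x)`. -/
inductive Path {C : Type v} [Category.{w} C] (F : C ⥤ LoSet Act) (X : Cᵒᵖ ⥤ Type w') :
    {U V : C} → X.obj (op U) → X.obj (op V) → Type (max u v w w') where
  | nil {U : C} (x : X.obj (op U)) : Path F X x x
  | up {U V W : C} {x : X.obj (op U)} {y : X.obj (op V)} {z : X.obj (op W)} (d : U ⟶ V)
      (hB : (F.map d : Coface (F.obj U) (F.obj V)).B = ∅) (hx : X.map d.op y = x)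
      (p : Path F X y z) : Path F X x z
  | down {U V W : C} {x : X.obj (op U)} {y : X.obj (op V)} {z : X.obj (op W)} (d : V ⟶ U)
      (hA : (F.map d : Coface (F.obj V) (F.obj U)).A = ∅) (hy : X.map d.op x = y)
      (p : Path F X y z) : Path F X x z

/-- The ipomset of a path: the gluing composition of the ipomsets of its steps. -/
noncomputable def Path.ev {C : Type v} [Category.{w} C] {F : C ⥤ LoSet Act}
    {X : Cᵒᵖ ⥤ Type w'} {U V : C} {x : X.obj (op U)} {y : X.obj (op V)} :
    Path F X x y → IPosetArrow (F.obj U) (F.obj V)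
  | .nil _ => IPosetArrow.id _
  | .up d _ _ p => (IPosetArrow.starter (F.map d)).comp p.ev
  | .down d _ _ p => (IPosetArrow.terminator (F.map d)).comp p.ev

/-! ### Higher-dimensional automata -/

/-- A higher-dimensional automaton: a finite precubical set with start and accept cells. -/
structure HDA (Act : Type u) where
  X : (LoSet Act)ᵒᵖ ⥤ Type u
  finite : Finite (Σ U : LoSet Act, X.obj (op U))
  start : ∀ U : LoSet Act, Set (X.obj (op U))
  accept : ∀ U : LoSet Act, Set (X.obj (op U))

/-- A higher-dimensional automaton with interfaces: a finite ipc-set with start and accept cells,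
such that all events of start cells are in the source interface and all events of accept cells are
in the target interface. -/
structure IHDA (Act : Type u) where
  X : (ILoSet Act)ᵒᵖ ⥤ Type u
  finite : Finite (Σ U : ILoSet Act, X.obj (op U))
  start : ∀ U : ILoSet Act, Set (X.obj (op U))
  accept : ∀ U : ILoSet Act, Set (X.obj (op U))
  start_interface : ∀ U, ∀ x ∈ start U, U.S = Set.univ
  accept_interface : ∀ U, ∀ x ∈ accept U, U.T = Set.univ

/-- The set of ipomsets of accepting paths of an HDA. -/
def HDA.lang (H : HDA Act) : Set (Ipomset Act) :=
  {P | ∃ (U V : LoSet Act) (x : H.X.obj (op U)) (y : H.X.obj (op V))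
    (p : Path (𝟭 (LoSet Act)) H.X x y),
    x ∈ H.start U ∧ y ∈ H.accept V ∧ P = Ipomset.mk p.ev.P}

/-- The set of ipomsets of accepting paths of an iHDA. -/
def IHDA.lang (H : IHDA Act) : Set (Ipomset Act) :=
  {P | ∃ (U V : ILoSet Act) (x : H.X.obj (op U)) (y : H.X.obj (op V))
    (p : Path (forgetInterfaces Act) H.X x y),
    x ∈ H.start U ∧ y ∈ H.accept V ∧ P = Ipomset.mk p.ev.P}

/-- The language is recognised by some HDA. -/
def IpomsetLanguage.RecognisedByHDA (L : IpomsetLanguage Act) : Prop :=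
  ∃ H : HDA Act, H.lang = L.carrier

/-- The language is recognised by some iHDA. -/
def IpomsetLanguage.RecognisedByIHDA (L : IpomsetLanguage Act) : Prop :=
  ∃ H : IHDA Act, H.lang = L.carrier

end HigherDim

/-!
An iposet belongs to `L⁺` if and only if it is interval and subsumed by the iposet of a run of a
finite automaton: the nodes are the cells of an automaton for `L`, the edges are the up- and
down-steps, and identity edges lead from the accept cells to the start cells with the same events.
When a run is cut according to a factorisation `p * q`, the cut passes through a node `z`, some of
whose events may be unstarted or terminated at the interface of `p` and `q`. Hence the acceptance of
`p * q` depends on `p` only through the set of pairs of a node `z` and a coface map into its events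
which `p` can reach, so that `L⁺` has finitely many quotients.

The converse direction is the Myhill–Nerode construction. The quotients of `L⁺` do not form a
precubical set themselves, since the quotient by `p` does not determine those by the faces of `p`;
so a cell over `U` records a quotient for each coface map into `U`. A face that would unstart an
event of the source interface does not exist, and any continuation is allowed there. An automaton
with interfaces is obtained from the resulting one by equipping its cells with arbitrary interfaces.
-/

namespace HigherDim

universe u v w w'

variable {Act : Type u}

/-! ### Subsumptions and lax embeddings -/

namespace IPoset

variable {P Q R : IPoset Act}

instance (P : IPoset Act) : Finite P.carrier := P.finite

theorem evo_asymm {x y : P.carrier} (h : P.evo x y) : ¬ P.evo y x :=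
  fun h' => P.evo_irrefl _ (P.evo_trans _ _ _ h h')

instance : Preorder (IPoset Act) where
  le P Q := Nonempty (Subsumption P Q)
  le_refl P := ⟨.refl P⟩
  le_trans _ _ _ := fun ⟨f⟩ ⟨g⟩ => ⟨f.trans g⟩

theorem le_of_equiv (h : P ≈ Q) : P ≤ Q :=
  h.elim fun f => ⟨f.toSubsumption⟩

theorem Subsumption.map_prec_of_endo (f : Subsumption P P) {x y : P.carrier} (h : P.prec x y) :
    P.prec (f.toEquiv x) (f.toEquiv y) := by
  let σ := f.toEquiv.prodCongr f.toEquiv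
  have hsub : σ ⁻¹' {z | P.prec z.1 z.2} ⊆ {z | P.prec z.1 z.2} :=
    fun z hz => f.reflect_prec _ _ hz
  have hcard : {z : P.carrier × P.carrier | P.prec z.1 z.2}.ncard ≤
      (σ ⁻¹' {z | P.prec z.1 z.2}).ncard := by
    rw [← Equiv.image_symm_eq_preimage, Set.ncard_image_of_injective _ σ.symm.injective]
  exact (Set.eq_of_subset_of_ncard_le hsub hcard).ge (show (x, y) ∈ {z | P.prec z.1 z.2} from h)

theorem equiv_of_le_of_le (h : P ≤ Q) (h' : Q ≤ P) : P ≈ Q := by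
  obtain ⟨f⟩ := h
  obtain ⟨g⟩ := h'
  exact ⟨{ f with map_prec := fun x y hxy =>
    g.reflect_prec _ _ ((f.trans g).map_prec_of_endo hxy) }⟩

theorem IsInterval.of_equiv (hP : P.IsInterval) (h : P ≈ Q) : Q.IsInterval :=
  h.elim fun f => Ipomset.isInterval_of_iso f hP

/-- Time reversal: precedence is inverted and the interfaces are exchanged, while the event order
is kept. Statements about target interfaces follow from those about source interfaces. -/
def reverse (P : IPoset Act) : IPoset Act where
  carrier := P.carrier
  finite := P.finite
  prec x y := P.prec y x
  evo := P.evo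
  S := P.T
  T := P.S
  lab := P.lab
  prec_irrefl := P.prec_irrefl
  prec_trans _ _ _ h h' := P.prec_trans _ _ _ h' h
  evo_irrefl := P.evo_irrefl
  evo_trans := P.evo_trans
  comparable x y := by
    rcases P.comparable x y with h | h | h | h <;> tauto
  S_minimal := P.T_maximal
  T_maximal := P.S_minimal

theorem IsInterval.reverse (hP : P.IsInterval) : P.reverse.IsInterval := by
  obtain ⟨b, e, hbe, h⟩ := hP
  exact ⟨-e, -b, fun x => neg_le_neg (hbe x), fun x y => (h y x).trans neg_lt_neg_iff.symm⟩

theorem IsInterval.exists_neg (hP : P.IsInterval) :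
    ∃ b e : P.carrier → ℝ,
      (∀ x, b x ≤ e x) ∧ (∀ x y, P.prec x y ↔ e x < b y) ∧ ∀ x, e x < 0 := by
  obtain ⟨b, e, hbe, h⟩ := hP
  obtain ⟨M, hM⟩ := (Set.finite_range e).bddAbove
  refine ⟨fun x => b x - (M + 1), fun x => e x - (M + 1), fun x => ?_, fun x y => ?_, fun x => ?_⟩
  · exact sub_le_sub_right (hbe x) _
  · rw [h, sub_lt_sub_iff_right]
  · linarith [hM ⟨x, rfl⟩]

theorem IsInterval.exists_pos (hP : P.IsInterval) :
    ∃ b e : P.carrier → ℝ,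
      (∀ x, b x ≤ e x) ∧ (∀ x y, P.prec x y ↔ e x < b y) ∧ ∀ x, 0 < b x := by
  obtain ⟨b, e, hbe, h, hneg⟩ := hP.reverse.exists_neg
  exact ⟨-e, -b, fun x => neg_le_neg (hbe x), fun x y => (h y x).trans neg_lt_neg_iff.symm,
    fun x => neg_pos.2 (hneg x)⟩

/-- A label-preserving injection that reflects precedence and preserves the event order of
concurrent events: a subsumption onto a part of `Q`, regardless of interfaces. -/
structure LaxEmbedding (P Q : IPoset Act) where
  toFun : P.carrier → Q.carrier
  injective : Function.Injective toFun
  map_lab : ∀ x, Q.lab (toFun x) = P.lab x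
  reflect_prec : ∀ x y, Q.prec (toFun x) (toFun y) → P.prec x y
  map_evo : ∀ x y, P.evo x y → ¬ P.prec x y → ¬ P.prec y x → Q.evo (toFun x) (toFun y)

instance : CoeFun (LaxEmbedding P Q) fun _ => P.carrier → Q.carrier := ⟨LaxEmbedding.toFun⟩

namespace LaxEmbedding

/-- The identity lax embedding. -/
def refl (P : IPoset Act) : LaxEmbedding P P where
  toFun x := x
  injective _ _ h := h
  map_lab _ := rfl
  reflect_prec _ _ h := h
  map_evo _ _ h _ _ := h

/-- Composition of lax embeddings, in diagrammatic order. -/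
def trans (f : LaxEmbedding P Q) (g : LaxEmbedding Q R) : LaxEmbedding P R where
  toFun x := g (f x)
  injective := g.injective.comp f.injective
  map_lab x := (g.map_lab _).trans (f.map_lab x)
  reflect_prec x y h := f.reflect_prec x y (g.reflect_prec _ _ h)
  map_evo x y h h₁ h₂ := g.map_evo _ _ (f.map_evo x y h h₁ h₂)
    (fun h₃ => h₁ (f.reflect_prec _ _ h₃)) (fun h₃ => h₂ (f.reflect_prec _ _ h₃))

theorem le_of_surjective (f : LaxEmbedding P Q) (hf : Function.Surjective f)
    (hS : f '' P.S = Q.S) (hT : f '' P.T = Q.T) : P ≤ Q :=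
  ⟨{ toEquiv := Equiv.ofBijective f ⟨f.injective, hf⟩
     map_S := hS
     map_T := hT
     map_lab := f.map_lab
     reflect_prec := f.reflect_prec
     map_evo := f.map_evo }⟩

theorem equiv_of_surjective (f : LaxEmbedding P Q) (hf : Function.Surjective f)
    (hS : f '' P.S = Q.S) (hT : f '' P.T = Q.T)
    (hprec : ∀ x y, P.prec x y → Q.prec (f x) (f y)) : P ≈ Q :=
  ⟨{ toEquiv := Equiv.ofBijective f ⟨f.injective, hf⟩
     map_S := hS
     map_T := hT
     map_lab := f.map_lab
     reflect_prec := f.reflect_prec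
     map_evo := f.map_evo
     map_prec := hprec }⟩

theorem reflect_evo (f : LaxEmbedding P Q) (hf : ∀ x y, P.prec x y → Q.prec (f x) (f y))
    {x y : P.carrier} (h : Q.evo (f x) (f y)) (h₁ : ¬ Q.prec (f x) (f y))
    (h₂ : ¬ Q.prec (f y) (f x)) : P.evo x y := by
  have h₁' : ¬ P.prec x y := fun h' => h₁ (hf _ _ h')
  have h₂' : ¬ P.prec y x := fun h' => h₂ (hf _ _ h')
  rcases P.comparable x y with rfl | h₃ | h₃ | h₃ | h₃
  · exact absurd h (Q.evo_irrefl _)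
  · exact absurd h₃ h₁'
  · exact absurd h₃ h₂'
  · exact h₃
  · exact absurd h (evo_asymm (f.map_evo _ _ h₃ h₂' h₁'))

theorem exists_lift (f : LaxEmbedding P R) (g : LaxEmbedding Q R)
    (hg : ∀ x y, Q.prec x y → R.prec (g x) (g y)) (h : ∀ x, ∃ y, g y = f x) :
    ∃ e : LaxEmbedding P Q, ∀ x, g (e x) = f x := by
  choose e he using h
  have reflect : ∀ x y, Q.prec (e x) (e y) → P.prec x y := fun x y h =>
    f.reflect_prec _ _ (by simpa only [he] using hg _ _ h)
  refine ⟨⟨e, fun x y h => f.injective ?_, fun x => ?_, reflect, fun x y h h₁ h₂ => ?_⟩, he⟩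
  · rw [← he, h, he]
  · rw [← g.map_lab, he, f.map_lab]
  · refine g.reflect_evo hg ?_ ?_ ?_
    · rw [he, he]
      exact f.map_evo _ _ h h₁ h₂
    · exact fun h' => h₁ (reflect _ _ (g.reflect_prec _ _ h'))
    · exact fun h' => h₂ (reflect _ _ (g.reflect_prec _ _ h'))

end LaxEmbedding

/-- The lax embedding underlying a subsumption. -/
def Subsumption.toLaxEmbedding (f : Subsumption P Q) : LaxEmbedding P Q where
  toFun := f.toEquiv
  injective := f.toEquiv.injective
  map_lab := f.map_lab
  reflect_prec := f.reflect_prec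
  map_evo := f.map_evo

/-- The lax embedding between the reversed iposets. -/
def LaxEmbedding.reverse (f : LaxEmbedding P Q) : LaxEmbedding P.reverse Q.reverse where
  toFun := f
  injective := f.injective
  map_lab := f.map_lab
  reflect_prec _ _ h := f.reflect_prec _ _ h
  map_evo _ _ h h₁ h₂ := f.map_evo _ _ h h₂ h₁

theorem reverse_le_reverse (h : P ≤ Q) : P.reverse ≤ Q.reverse :=
  h.elim fun f => f.toLaxEmbedding.reverse.le_of_surjective f.toEquiv.surjective f.map_T f.map_S

end IPoset

/-! ### Gluings -/

theorem orderEmbedding_self_apply {α : Type*} [LinearOrder α] [Finite α] (f : α ↪o α) (a : α) :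
    f a = a := by
  have hf : Set.range f = Set.range (RelEmbedding.refl (· ≤ · : α → α → Prop)) := by
    rw [(Finite.surjective_of_injective f.injective).range_eq]
    exact Set.range_id.symm
  rw [OrderEmbedding.range_inj.1 hf]
  rfl

theorem LoSet.eq_of_orderEmbedding_of_surjective {U V : LoSet Act} (m : Fin U.n ↪o Fin V.n)
    (hm : Function.Surjective m) (hlab : ∀ i, V.lab (m i) = U.lab i) : U = V := by
  obtain ⟨n, lab⟩ := U
  obtain ⟨k, lab'⟩ := V
  obtain rfl : n = k := by
    simpa using Fintype.card_congr (Equiv.ofBijective m ⟨m.injective, hm⟩)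
  obtain rfl : lab = lab' := by
    ext i
    exact (hlab i).symm.trans (congrArg lab' (orderEmbedding_self_apply m i))
  rfl

namespace IPosetArrow

open IPoset

variable {U V W U' V' : LoSet Act}

theorem src_mem (p : IPosetArrow U V) (i : Fin U.n) : (p.src i : p.P.carrier) ∈ p.P.S :=
  (p.src i).2

theorem tgt_mem (p : IPosetArrow U V) (i : Fin V.n) : (p.tgt i : p.P.carrier) ∈ p.P.T :=
  (p.tgt i).2

theorem exists_src_eq (p : IPosetArrow U V) {x : p.P.carrier} (hx : x ∈ p.P.S) :
    ∃ i, p.src i = x :=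
  (p.src.surjective ⟨x, hx⟩).imp fun _ h => congrArg Subtype.val h

theorem exists_tgt_eq (p : IPosetArrow U V) {x : p.P.carrier} (hx : x ∈ p.P.T) :
    ∃ i, p.tgt i = x :=
  (p.tgt.surjective ⟨x, hx⟩).imp fun _ h => congrArg Subtype.val h

theorem src_coe_injective (p : IPosetArrow U V) :
    Function.Injective fun i => (p.src i : p.P.carrier) :=
  Subtype.val_injective.comp p.src.injective

theorem tgt_coe_injective (p : IPosetArrow U V) :
    Function.Injective fun i => (p.tgt i : p.P.carrier) :=
  Subtype.val_injective.comp p.tgt.injective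

/-- The reversed iposet as an arrow in the opposite direction. -/
def reverse (p : IPosetArrow U V) : IPosetArrow V U where
  P := p.P.reverse
  src := p.tgt
  src_evo := p.tgt_evo
  src_lab := p.tgt_lab
  tgt := p.src
  tgt_evo := p.src_evo
  tgt_lab := p.src_lab

theorem exists_orderEmbedding_tgt {p : IPosetArrow U V} {p' : IPosetArrow U' V'}
    (f : LaxEmbedding p.P p'.P) (hf : ∀ i, f (p.tgt i) ∈ p'.P.T) :
    ∃ m : Fin V.n ↪o Fin V'.n,
      (∀ i, f (p.tgt i) = p'.tgt (m i)) ∧ ∀ i, V'.lab (m i) = V.lab i := by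
  choose m hm using fun i => p'.exists_tgt_eq (hf i)
  have mono : StrictMono m := fun i j hij => by
    rw [p'.tgt_evo, hm, hm]
    exact f.map_evo _ _ ((p.tgt_evo i j).1 hij) (p.P.T_maximal _ (p.tgt_mem i) _)
      (p.P.T_maximal _ (p.tgt_mem j) _)
  refine ⟨.ofStrictMono m mono, fun i => (hm i).symm, fun i => ?_⟩
  rw [OrderEmbedding.coe_ofStrictMono, ← p'.tgt_lab, hm, f.map_lab, p.tgt_lab]

theorem map_tgt {p : IPosetArrow U V} {p' : IPosetArrow U' V} (f : LaxEmbedding p.P p'.P)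
    (hf : ∀ x ∈ p.P.T, f x ∈ p'.P.T) (i : Fin V.n) : f (p.tgt i) = p'.tgt i := by
  obtain ⟨m, hm, -⟩ := exists_orderEmbedding_tgt f fun i => hf _ (p.tgt_mem i)
  rw [hm, orderEmbedding_self_apply]

theorem map_src {p : IPosetArrow U V} {p' : IPosetArrow U V'} (f : LaxEmbedding p.P p'.P)
    (hf : ∀ x ∈ p.P.S, f x ∈ p'.P.S) (i : Fin U.n) : f (p.src i) = p'.src i :=
  map_tgt (p := p.reverse) (p' := p'.reverse) f.reverse hf i

theorem tgt_eq_of_le {p : IPosetArrow U V} {p' : IPosetArrow U' V'} (h : p.P ≤ p'.P) : V = V' := by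
  obtain ⟨f⟩ := h
  obtain ⟨m, hm, hlab⟩ := exists_orderEmbedding_tgt f.toLaxEmbedding
    fun i => f.map_T ▸ Set.mem_image_of_mem _ (p.tgt_mem i)
  refine LoSet.eq_of_orderEmbedding_of_surjective m (fun j => ?_) hlab
  obtain ⟨x, hx, hxj⟩ := f.map_T.ge (p'.tgt_mem j)
  obtain ⟨i, rfl⟩ := p.exists_tgt_eq hx
  exact ⟨i, p'.tgt_coe_injective ((hm i).symm.trans hxj)⟩

theorem src_eq_of_le {p : IPosetArrow U V} {p' : IPosetArrow U' V'} (h : p.P ≤ p'.P) : U = U' :=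
  tgt_eq_of_le (p := p.reverse) (p' := p'.reverse) (reverse_le_reverse h)

/-- Compatible lax embeddings of `p` and `q` into an iposet `R`, glueing the target interface of
`p` to the source interface of `q`, such that no event of `q` precedes an event of `p`. -/
structure Cocone (p : IPosetArrow U V) (q : IPosetArrow V W) (R : IPoset Act) where
  inl : LaxEmbedding p.P R
  inr : LaxEmbedding q.P R
  inl_tgt : ∀ i, inl (p.tgt i) = inr (q.src i)
  mem_T_of_eq : ∀ x y, inl x = inr y → x ∈ p.P.T
  not_prec_inr_inl : ∀ x y, ¬ R.prec (inr y) (inl x)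

/-- A presentation of `R` as subsumed by the gluing composition of `p` and `q`. -/
structure LaxGluing (p : IPosetArrow U V) (q : IPosetArrow V W) (R : IPoset Act) extends
    Cocone p q R where
  cover : ∀ z, (∃ x, inl x = z) ∨ ∃ y, inr y = z
  image_S : inl '' p.P.S = R.S
  image_T : inr '' q.P.T = R.T

/-- A presentation of `R` as the gluing composition of `p` and `q`. -/
structure Gluing (p : IPosetArrow U V) (q : IPosetArrow V W) (R : IPoset Act) extends
    LaxGluing p q R where
  map_prec_inl : ∀ x y, p.P.prec x y → R.prec (inl x) (inl y)
  map_prec_inr : ∀ x y, q.P.prec x y → R.prec (inr x) (inr y)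
  prec_inl_inr : ∀ x y, x ∉ p.P.T → y ∉ q.P.S → R.prec (inl x) (inr y)

variable {p : IPosetArrow U V} {q : IPosetArrow V W} {R Z : IPoset Act}

theorem Cocone.exists_of_inl_eq_inr (c : Cocone p q R) {x : p.P.carrier} {y : q.P.carrier}
    (h : c.inl x = c.inr y) : ∃ i, p.tgt i = x ∧ q.src i = y := by
  obtain ⟨i, rfl⟩ := p.exists_tgt_eq (c.mem_T_of_eq _ _ h)
  exact ⟨i, rfl, c.inr.injective ((c.inl_tgt i).symm.trans h)⟩

/-- The cocone of the reversed arrows. -/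
def Cocone.reverse (c : Cocone p q R) : Cocone q.reverse p.reverse R.reverse where
  inl := c.inr.reverse
  inr := c.inl.reverse
  inl_tgt i := (c.inl_tgt i).symm
  mem_T_of_eq _ _ h := by
    obtain ⟨i, -, rfl⟩ := c.exists_of_inl_eq_inr h.symm
    exact q.src_mem i
  not_prec_inr_inl x y := c.not_prec_inr_inl y x

namespace LaxGluing

/-- The lax gluing of the reversed arrows. -/
def reverse (l : LaxGluing p q R) : LaxGluing q.reverse p.reverse R.reverse where
  toCocone := l.toCocone.reverse
  cover z := (l.cover z).symm
  image_S := l.image_T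
  image_T := l.image_S

theorem cover_right (l : LaxGluing p q R) (z : R.carrier) :
    (∃ x, l.inl x = z) ∨ ∃ y ∉ q.P.S, l.inr y = z := by
  rcases l.cover z with h | ⟨y, rfl⟩
  · exact .inl h
  by_cases hy : y ∈ q.P.S
  · obtain ⟨i, rfl⟩ := q.exists_src_eq hy
    exact .inl ⟨_, l.inl_tgt i⟩
  · exact .inr ⟨y, hy, rfl⟩

theorem cover_left (l : LaxGluing p q R) (z : R.carrier) :
    (∃ y, l.inr y = z) ∨ ∃ x ∉ p.P.T, l.inl x = z :=
  l.reverse.cover_right z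

theorem inl_mem_S (l : LaxGluing p q R) {x : p.P.carrier} : l.inl x ∈ R.S ↔ x ∈ p.P.S := by
  rw [← l.image_S, l.inl.injective.mem_set_image]

theorem inr_mem_T (l : LaxGluing p q R) {y : q.P.carrier} : l.inr y ∈ R.T ↔ y ∈ q.P.T := by
  rw [← l.image_T, l.inr.injective.mem_set_image]

theorem inl_notMem_T (l : LaxGluing p q R) {x : p.P.carrier} (hx : x ∉ p.P.T) :
    l.inl x ∉ R.T := by
  rw [← l.image_T]
  rintro ⟨y, -, hy⟩
  exact hx (l.mem_T_of_eq _ _ hy.symm)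

/-- A lax gluing followed by a subsumption. -/
def trans (l : LaxGluing p q R) (f : Subsumption R Z) : LaxGluing p q Z where
  inl := l.inl.trans f.toLaxEmbedding
  inr := l.inr.trans f.toLaxEmbedding
  inl_tgt i := congrArg f.toEquiv (l.inl_tgt i)
  mem_T_of_eq x y h := l.mem_T_of_eq x y (f.toEquiv.injective h)
  not_prec_inr_inl x y h := l.not_prec_inr_inl x y (f.reflect_prec _ _ h)
  cover z := by
    obtain ⟨z, rfl⟩ := f.toEquiv.surjective z
    exact (l.cover z).imp (Exists.imp fun _ => congrArg _) (Exists.imp fun _ => congrArg _)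
  image_S := by
    rw [← f.map_S, ← l.image_S, Set.image_image]
    rfl
  image_T := by
    rw [← f.map_T, ← l.image_T, Set.image_image]
    rfl

end LaxGluing

namespace Gluing

/-- The gluing of the reversed arrows. -/
def reverse (g : Gluing p q R) : Gluing q.reverse p.reverse R.reverse where
  toLaxGluing := g.toLaxGluing.reverse
  map_prec_inl x y h := g.map_prec_inr y x h
  map_prec_inr x y h := g.map_prec_inl y x h
  prec_inl_inr x y hx hy := g.prec_inl_inr y x hy hx

theorem exists_desc_fun (g : Gluing p q R) (c : Cocone p q Z) :
    ∃ f : R.carrier → Z.carrier, (∀ x, f (g.inl x) = c.inl x) ∧ ∀ y, f (g.inr y) = c.inr y := by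
  have h : ∀ z, ∃ t, (∀ x, g.inl x = z → c.inl x = t) ∧ ∀ y, g.inr y = z → c.inr y = t := by
    intro z
    rcases g.cover z with ⟨x, rfl⟩ | ⟨y, rfl⟩
    · refine ⟨c.inl x, fun x' h => by rw [g.inl.injective h], fun y h => ?_⟩
      obtain ⟨i, rfl, rfl⟩ := g.exists_of_inl_eq_inr h.symm
      exact (c.inl_tgt i).symm
    · refine ⟨c.inr y, fun x h => ?_, fun y' h => by rw [g.inr.injective h]⟩
      obtain ⟨i, rfl, rfl⟩ := g.exists_of_inl_eq_inr h
      exact c.inl_tgt i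
  choose f hfl hfr using h
  exact ⟨f, fun x => (hfl _ x rfl).symm, fun y => (hfr _ y rfl).symm⟩

theorem exists_of_concurrent (g : Gluing p q R) {u v : R.carrier} (h₁ : ¬ R.prec u v)
    (h₂ : ¬ R.prec v u) :
    (∃ x y, g.inl x = u ∧ g.inl y = v) ∨ ∃ x y, g.inr x = u ∧ g.inr y = v := by
  by_cases hu : ∃ x, g.inl x = u
  · obtain ⟨x, rfl⟩ := hu
    rcases g.cover_right v with ⟨y, rfl⟩ | ⟨y, hy, rfl⟩
    · exact .inl ⟨x, y, rfl, rfl⟩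
    rcases g.cover_left (g.inl x) with ⟨x', hx'⟩ | ⟨x', hx', h⟩
    · exact .inr ⟨x', y, hx', rfl⟩
    · exact absurd (h ▸ g.prec_inl_inr _ _ hx' hy) h₁
  · obtain ⟨x, hx, rfl⟩ := (g.cover_right u).resolve_left hu
    rcases g.cover_left v with ⟨y, rfl⟩ | ⟨y, hy, rfl⟩
    · exact .inr ⟨x, y, rfl, rfl⟩
    · exact absurd (g.prec_inl_inr _ _ hy hx) h₂

theorem exists_desc (g : Gluing p q R) (c : Cocone p q Z) :
    ∃ f : LaxEmbedding R Z, (∀ x, f (g.inl x) = c.inl x) ∧ ∀ y, f (g.inr y) = c.inr y := by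
  obtain ⟨f, hfl, hfr⟩ := g.exists_desc_fun c
  refine ⟨⟨f, fun u v => ?_, fun z => ?_, fun u v => ?_, fun u v h h₁ h₂ => ?_⟩, hfl, hfr⟩
  · rcases g.cover_left u with ⟨x, rfl⟩ | ⟨x, hx, rfl⟩ <;>
      rcases g.cover_right v with ⟨y, rfl⟩ | ⟨y, -, rfl⟩ <;>
      simp only [hfl, hfr] <;> intro h
    · obtain ⟨i, rfl, rfl⟩ := c.exists_of_inl_eq_inr h.symm
      exact (g.inl_tgt i).symm
    · rw [c.inr.injective h]
    · rw [c.inl.injective h]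
    · exact absurd (c.mem_T_of_eq _ _ h) hx
  · rcases g.cover z with ⟨x, rfl⟩ | ⟨y, rfl⟩
    · rw [hfl, c.inl.map_lab, g.inl.map_lab]
    · rw [hfr, c.inr.map_lab, g.inr.map_lab]
  · rcases g.cover_left u with ⟨x, rfl⟩ | ⟨x, hx, rfl⟩ <;>
      rcases g.cover_right v with ⟨y, rfl⟩ | ⟨y, hy, rfl⟩ <;>
      simp only [hfl, hfr] <;> intro h
    · exact absurd h (c.not_prec_inr_inl _ _)
    · exact g.map_prec_inr _ _ (c.inr.reflect_prec _ _ h)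
    · exact g.map_prec_inl _ _ (c.inl.reflect_prec _ _ h)
    · exact g.prec_inl_inr _ _ hx hy
  · rcases g.exists_of_concurrent h₁ h₂ with ⟨x, y, rfl, rfl⟩ | ⟨x, y, rfl, rfl⟩
    · rw [hfl, hfl]
      exact c.inl.map_evo _ _ (g.inl.reflect_evo g.map_prec_inl h h₁ h₂)
        (fun h' => h₁ (g.map_prec_inl _ _ h')) (fun h' => h₂ (g.map_prec_inl _ _ h'))
    · rw [hfr, hfr]
      exact c.inr.map_evo _ _ (g.inr.reflect_evo g.map_prec_inr h h₁ h₂)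
        (fun h' => h₁ (g.map_prec_inr _ _ h')) (fun h' => h₂ (g.map_prec_inr _ _ h'))

theorem le (g : Gluing p q R) (l : LaxGluing p q Z) : R ≤ Z := by
  obtain ⟨f, hfl, hfr⟩ := g.exists_desc l.toCocone
  refine f.le_of_surjective (fun z => ?_) ?_ ?_
  · rcases l.cover z with ⟨x, rfl⟩ | ⟨y, rfl⟩
    exacts [⟨_, hfl x⟩, ⟨_, hfr y⟩]
  · rw [← g.image_S, ← l.image_S, Set.image_image]
    simp only [hfl]
  · rw [← g.image_T, ← l.image_T, Set.image_image]
    simp only [hfr]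

theorem equiv (g : Gluing p q R) (g' : Gluing p q Z) : R ≈ Z :=
  equiv_of_le_of_le (g.le g'.toLaxGluing) (g'.le g.toLaxGluing)

theorem map_prec_of_desc (g : Gluing p q R) {f : LaxEmbedding R Z}
    (hl : ∀ x y, p.P.prec x y → Z.prec (f (g.inl x)) (f (g.inl y)))
    (hr : ∀ x y, q.P.prec x y → Z.prec (f (g.inr x)) (f (g.inr y)))
    (hlr : ∀ x y, x ∉ p.P.T → y ∉ q.P.S → Z.prec (f (g.inl x)) (f (g.inr y)))
    (u v : R.carrier) (h : R.prec u v) : Z.prec (f u) (f v) := by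
  rcases g.cover_left u with ⟨x, rfl⟩ | ⟨x, hx, rfl⟩ <;>
    rcases g.cover_right v with ⟨y, rfl⟩ | ⟨y, hy, rfl⟩
  · exact absurd h (g.not_prec_inr_inl _ _)
  · exact hr _ _ (g.inr.reflect_prec _ _ h)
  · exact hl _ _ (g.inl.reflect_prec _ _ h)
  · exact hlr _ _ hx hy

theorem isInterval (g : Gluing p q R) (hp : p.P.IsInterval) (hq : q.P.IsInterval) :
    R.IsInterval := by
  obtain ⟨b₁, e₁, hbe₁, h₁, neg⟩ := hp.exists_neg
  obtain ⟨b₂, e₂, hbe₂, h₂, pos⟩ := hq.exists_pos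
  let b := Function.extend g.inl b₁ (Function.extend g.inr b₂ 0)
  let e := Function.extend g.inr e₂ (Function.extend g.inl e₁ 0)
  have b_inl : ∀ x, b (g.inl x) = b₁ x := g.inl.injective.extend_apply _ _
  have e_inr : ∀ y, e (g.inr y) = e₂ y := g.inr.injective.extend_apply _ _
  have b_inr : ∀ y, y ∉ q.P.S → b (g.inr y) = b₂ y := fun y hy => by
    have : ¬ ∃ x, g.inl x = g.inr y := fun ⟨x, hx⟩ => by
      obtain ⟨i, -, rfl⟩ := g.exists_of_inl_eq_inr hx
      exact hy (q.src_mem i)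
    exact (Function.extend_apply' _ _ _ this).trans (g.inr.injective.extend_apply _ _ _)
  have e_inl : ∀ x, x ∉ p.P.T → e (g.inl x) = e₁ x := fun x hx => by
    have : ¬ ∃ y, g.inr y = g.inl x := fun ⟨y, hy⟩ => hx (g.mem_T_of_eq _ _ hy.symm)
    exact (Function.extend_apply' _ _ _ this).trans (g.inl.injective.extend_apply _ _ _)
  refine ⟨b, e, fun z => ?_, fun u v => ?_⟩
  · rcases g.cover_right z with ⟨x, rfl⟩ | ⟨y, hy, rfl⟩
    · by_cases hx : x ∈ p.P.T
      · obtain ⟨i, rfl⟩ := p.exists_tgt_eq hx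
        rw [b_inl, g.inl_tgt, e_inr]
        linarith [hbe₁ (p.tgt i), neg (p.tgt i), hbe₂ (q.src i), pos (q.src i)]
      · rw [b_inl, e_inl x hx]
        exact hbe₁ x
    · rw [b_inr y hy, e_inr]
      exact hbe₂ y
  · rcases g.cover_left u with ⟨x, rfl⟩ | ⟨x, hx, rfl⟩ <;>
      rcases g.cover_right v with ⟨y, rfl⟩ | ⟨y, hy, rfl⟩
    · rw [e_inr, b_inl]
      refine iff_of_false (g.not_prec_inr_inl _ _) ?_
      linarith [hbe₁ y, neg y, hbe₂ x, pos x]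
    · rw [e_inr, b_inr y hy, ← h₂]
      exact ⟨g.inr.reflect_prec _ _, g.map_prec_inr _ _⟩
    · rw [e_inl x hx, b_inl, ← h₁]
      exact ⟨g.inl.reflect_prec _ _, g.map_prec_inl _ _⟩
    · rw [e_inl x hx, b_inr y hy]
      exact iff_of_true (g.prec_inl_inr _ _ hx hy) ((neg x).trans (pos y))

end Gluing

end IPosetArrow

namespace IPosetArrow

open IPoset

variable {U V W X : LoSet Act}

/-- The structural inclusions present the gluing composition. -/
noncomputable def compGluing (p : IPosetArrow U V) (q : IPosetArrow V W) :
    Gluing p q (p.comp q).P where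
  inl :=
    { toFun := glueLeft
      injective := fun _ _ h => glueLeft_inj.1 h
      map_lab := fun _ => rfl
      reflect_prec := by
        rintro x y (⟨a, b, ha, hb, h⟩ | ⟨a, b, -, hb, h⟩ | ⟨a, b, -, hb, -, h₂⟩)
        · rwa [glueLeft_inj.1 ha, glueLeft_inj.1 hb]
        · obtain ⟨t, rfl, rfl⟩ := glueLeft_eq_glueRight.1 hb
          exact absurd h (q.P.S_minimal _ (Subtype.mem _) _)
        · obtain ⟨t, rfl, rfl⟩ := glueLeft_eq_glueRight.1 hb
          exact absurd (Subtype.mem _) h₂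
      map_evo := fun x y h _ _ => .single (.inl ⟨x, y, rfl, rfl, h⟩) }
  inr :=
    { toFun := glueRight (p.interfaceIso q)
      injective := fun _ _ h => glueRight_inj.1 h
      map_lab := fun y => by
        by_cases hy : y ∈ q.P.S
        · obtain ⟨t, ht⟩ := (p.interfaceIso q).toEquiv.surjective ⟨y, hy⟩
          obtain rfl : ((p.interfaceIso q).toEquiv t : q.P.carrier) = y := congrArg Subtype.val ht
          rw [← glueLeft_eq_glueRight.2 ⟨t, rfl, rfl⟩]
          exact ((p.interfaceIso q).lab_eq t).symm
        · simp [comp, glue, glueRight, hy]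
      reflect_prec := by
        rintro x y (⟨a, b, ha, -, h⟩ | ⟨a, b, ha, hb, h⟩ | ⟨a, b, ha, -, h₁, -⟩)
        · obtain ⟨t, rfl, rfl⟩ := glueLeft_eq_glueRight.1 ha.symm
          exact absurd h (p.P.T_maximal _ (Subtype.mem _) _)
        · rwa [glueRight_inj.1 ha, glueRight_inj.1 hb]
        · obtain ⟨t, rfl, rfl⟩ := glueLeft_eq_glueRight.1 ha.symm
          exact absurd (Subtype.mem _) h₁
      map_evo := fun x y h _ _ => .single (.inr ⟨x, y, rfl, rfl, h⟩) }
  inl_tgt i := glueLeft_eq_glueRight.2 ⟨p.tgt i, rfl, by simp [interfaceIso]⟩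
  mem_T_of_eq x y h := by
    obtain ⟨t, rfl, -⟩ := glueLeft_eq_glueRight.1 h
    exact t.2
  not_prec_inr_inl := by
    rintro x y (⟨a, b, ha, -, h⟩ | ⟨a, b, -, hb, h⟩ | ⟨a, b, -, hb, -, h₂⟩)
    · obtain ⟨t, rfl, rfl⟩ := glueLeft_eq_glueRight.1 ha.symm
      exact p.P.T_maximal _ t.2 _ h
    · obtain ⟨t, rfl, rfl⟩ := glueLeft_eq_glueRight.1 hb
      exact q.P.S_minimal _ (Subtype.mem _) _ h
    · obtain ⟨t, rfl, rfl⟩ := glueLeft_eq_glueRight.1 hb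
      exact h₂ (Subtype.mem _)
  cover z := by
    rcases exists_glueLeft_or_glueRight (f := p.interfaceIso q) z with ⟨x, rfl⟩ | ⟨y, -, rfl⟩
    exacts [.inl ⟨x, rfl⟩, .inr ⟨y, rfl⟩]
  image_S := rfl
  image_T := rfl
  map_prec_inl x y h := .inl ⟨x, y, rfl, rfl, h⟩
  map_prec_inr x y h := .inr (.inl ⟨x, y, rfl, rfl, h⟩)
  prec_inl_inr x y hx hy := .inr (.inr ⟨x, y, rfl, rfl, hx, hy⟩)

/-- Glueing an identity on the left. -/
def idGluing (q : IPosetArrow U V) : Gluing (id U) q q.P where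
  inl :=
    { toFun := fun i => q.src i
      injective := q.src_coe_injective
      map_lab := q.src_lab
      reflect_prec := fun _ j h => absurd h (q.P.S_minimal _ (q.src_mem j) _)
      map_evo := fun i j h _ _ => (q.src_evo i j).1 h }
  inr := .refl q.P
  inl_tgt _ := rfl
  mem_T_of_eq _ _ _ := trivial
  not_prec_inr_inl x y := q.P.S_minimal _ (q.src_mem x) y
  cover z := .inr ⟨z, rfl⟩
  image_S := Set.ext fun z =>
    ⟨by rintro ⟨i, -, rfl⟩; exact q.src_mem i, fun hz => (q.exists_src_eq hz).imp fun _ h =>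
      ⟨trivial, h⟩⟩
  image_T := Set.image_id _
  map_prec_inl _ _ h := h.elim
  map_prec_inr _ _ h := h
  prec_inl_inr _ _ hx := absurd trivial hx

theorem id_comp (q : IPosetArrow U V) : ((id U).comp q).P ≈ q.P :=
  (compGluing _ _).equiv (idGluing q)

theorem comp_id (q : IPosetArrow U V) : (q.comp (id V)).P ≈ q.P :=
  (compGluing _ _).equiv (idGluing q.reverse).reverse

section Assoc

variable {a : IPosetArrow X U} {b : IPosetArrow U V} {c : IPosetArrow V W} {s : IPosetArrow U W}
  {R : IPoset Act}

/-- The cocone obtained by splitting the right factor of a gluing. -/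
def Gluing.leftCocone (k : Gluing a s R) (h : Gluing b c s.P) : Cocone a b R where
  inl := k.inl
  inr := h.inl.trans k.inr
  inl_tgt i := (k.inl_tgt i).trans
    (congrArg k.inr (map_src h.inl (fun _ => h.inl_mem_S.2) i).symm)
  mem_T_of_eq x _ := k.mem_T_of_eq x _
  not_prec_inr_inl x _ := k.not_prec_inr_inl x _

theorem Gluing.exists_assocCocone (k : Gluing a s R) (h : Gluing b c s.P) :
    ∃ g : Cocone (a.comp b) c R,
      (∀ x, g.inl ((compGluing a b).inl x) = k.inl x) ∧
      (∀ y, g.inl ((compGluing a b).inr y) = k.inr (h.inl y)) ∧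
      ∀ z, g.inr z = k.inr (h.inr z) := by
  let g := compGluing a b
  obtain ⟨f, hfl, hfr⟩ := g.exists_desc (k.leftCocone h)
  replace hfl : ∀ x, f (g.inl x) = k.inl x := hfl
  replace hfr : ∀ y, f (g.inr y) = k.inr (h.inl y) := hfr
  refine ⟨⟨f, h.inr.trans k.inr, fun i => ?_, fun x y hxy => ?_, fun x y hxy => ?_⟩, hfl, hfr,
    fun _ => rfl⟩
  · exact (hfr _).trans (congrArg k.inr (h.inl_tgt i))
  · rcases g.cover_left x with ⟨u, rfl⟩ | ⟨u, hu, rfl⟩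
    · exact g.inr_mem_T.2 (h.mem_T_of_eq _ _ (k.inr.injective ((hfr u).symm.trans hxy)))
    · exact absurd (k.mem_T_of_eq _ _ ((hfl u).symm.trans hxy)) hu
  · rcases g.cover x with ⟨u, rfl⟩ | ⟨u, rfl⟩
    · exact k.not_prec_inr_inl _ _ (hfl u ▸ hxy)
    · exact h.not_prec_inr_inl _ _ (k.inr.reflect_prec _ _ (hfr u ▸ hxy))

theorem Gluing.exists_assoc (k : Gluing a s R) (h : Gluing b c s.P) :
    ∃ g : Gluing (a.comp b) c R,
      (∀ x, g.inl ((compGluing a b).inl x) = k.inl x) ∧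
      (∀ y, g.inl ((compGluing a b).inr y) = k.inr (h.inl y)) ∧
      ∀ z, g.inr z = k.inr (h.inr z) := by
  let g := compGluing a b
  obtain ⟨f, hfl, hfm, hfr⟩ := k.exists_assocCocone h
  refine ⟨⟨⟨f, fun z => ?_, ?_, ?_⟩, fun u v => ?_, fun x y hxy => ?_, fun x y hx hy => ?_⟩,
    hfl, hfm, hfr⟩
  · rcases k.cover z with ⟨x, rfl⟩ | ⟨y, rfl⟩
    · exact .inl ⟨_, hfl x⟩
    rcases h.cover y with ⟨y, rfl⟩ | ⟨y, rfl⟩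
    exacts [.inl ⟨_, hfm y⟩, .inr ⟨y, hfr y⟩]
  · rw [← g.image_S, Set.image_image, ← k.image_S]
    exact Set.image_congr fun x _ => hfl x
  · rw [← k.image_T, ← h.image_T, Set.image_image]
    exact Set.image_congr fun z _ => hfr z
  · refine g.map_prec_of_desc (fun x y hxy => ?_) (fun x y hxy => ?_) (fun x y hx hy => ?_) u v
    · rw [hfl, hfl]
      exact k.map_prec_inl _ _ hxy
    · rw [hfm, hfm]
      exact k.map_prec_inr _ _ (h.map_prec_inl _ _ hxy)
    · rw [hfl, hfm]
      exact k.prec_inl_inr _ _ hx (h.inl_mem_S.not.2 hy)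
  · rw [hfr, hfr]
    exact k.map_prec_inr _ _ (h.map_prec_inr _ _ hxy)
  · rw [hfr]
    rcases g.cover_left x with ⟨u, rfl⟩ | ⟨u, hu, rfl⟩
    · rw [hfm]
      exact k.map_prec_inr _ _ (h.prec_inl_inr _ _ (g.inr_mem_T.not.1 hx) hy)
    · rw [hfl]
      exact k.prec_inl_inr _ _ hu (h.reverse.inl_notMem_T hy)

theorem comp_assoc (p : IPosetArrow X U) (q : IPosetArrow U V) (r : IPosetArrow V W) :
    ((p.comp q).comp r).P ≈ (p.comp (q.comp r)).P := by
  obtain ⟨g, -⟩ := (compGluing p (q.comp r)).exists_assoc (compGluing q r)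
  exact (compGluing _ _).equiv g

end Assoc

end IPosetArrow

/-! ### Cutting a gluing in two -/

/-- The coface map obtained by exchanging the unstarted and the terminated events. -/
def Coface.swap {U V : LoSet Act} (d : Coface U V) : Coface U V where
  emb := d.emb
  A := d.B
  B := d.A
  lab := d.lab
  disj := d.disj.symm
  union := (Set.union_comm _ _).trans d.union

namespace IPosetArrow

open IPoset

variable {U V W U' V' W' : LoSet Act}

/-- `LowerPart p d w` embeds `p` into `w`, matching the source interfaces, and the target interfaces
along `d`, such that the image misses exactly the target events of `w` unstarted by `d`. In this
way `p` is the part of a longer iposet before a cut, where that cut meets `w`. -/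
structure LowerPart (p : IPosetArrow U V) (d : Coface V V') (w : IPosetArrow U' V') extends
    LaxEmbedding p.P w.P where
  mem_range_iff : ∀ z, z ∈ Set.range toFun ↔ ∀ i ∈ d.A, z ≠ w.tgt i
  map_tgt : ∀ i, toFun (p.tgt i) = w.tgt (d.emb i)
  image_S : toFun '' p.P.S = w.P.S

/-- The notion dual to `LowerPart`, for the part after a cut. -/
abbrev UpperPart (q : IPosetArrow V W) (d : Coface V V') (w : IPosetArrow V' W') : Type :=
  LowerPart q.reverse d.swap w.reverse

variable {p : IPosetArrow U V} {q : IPosetArrow V W} {d : Coface V V'} {a : IPosetArrow U' V'}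
  {b : IPosetArrow V' W'} {R : IPoset Act}

theorem LowerPart.tgt_mem_range (h : LowerPart p d a) {j : Fin V'.n} :
    (a.tgt j : a.P.carrier) ∈ Set.range h.toFun ↔ j ∉ d.A := by
  rw [h.mem_range_iff]
  refine ⟨fun h' hj => h' j hj rfl, fun hj i hi hij => hj ?_⟩
  rwa [a.tgt_coe_injective hij]

theorem LowerPart.exists_eq_tgt (h : LowerPart p d a) {z : a.P.carrier}
    (hz : z ∉ Set.range h.toFun) : ∃ i ∈ d.A, z = a.tgt i := by
  simpa only [h.mem_range_iff, not_forall, exists_prop, not_not] using hz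

theorem LowerPart.exists_tgt_eq (h : LowerPart p d a) {x : p.P.carrier} {j : Fin V'.n}
    (hx : h.toFun x = a.tgt j) (hj : j ∉ d.B) : ∃ i, p.tgt i = x ∧ d.emb i = j := by
  have hA : j ∉ d.A := h.tgt_mem_range.1 ⟨x, hx⟩
  obtain ⟨i, rfl⟩ : j ∈ Set.range d.emb := by
    rw [← Set.notMem_compl_iff, ← d.union]
    exact not_or.2 ⟨hA, hj⟩
  exact ⟨i, h.injective ((h.map_tgt i).trans hx.symm), rfl⟩

/-- Parts before and after a cut glue to a part of the whole. -/
def LowerPart.laxGluing (hp : LowerPart p d a) (hq : UpperPart q d b) (g : LaxGluing a b R) :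
    LaxGluing p q R where
  inl := hp.toLaxEmbedding.trans g.inl
  inr := hq.toLaxEmbedding.reverse.trans g.inr
  inl_tgt i := by
    have hl : hp.toFun (p.tgt i) = a.tgt (d.emb i) := hp.map_tgt i
    have hr : hq.toFun (q.reverse.tgt i) = b.reverse.tgt (d.emb i) := hq.map_tgt i
    exact (congrArg g.inl hl).trans ((g.inl_tgt _).trans (congrArg g.inr hr.symm))
  mem_T_of_eq x y h := by
    obtain ⟨j, hx, hy⟩ := g.exists_of_inl_eq_inr h
    have hj : j ∉ d.B := hq.tgt_mem_range.1 ⟨y, hy.symm⟩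
    obtain ⟨i, rfl, -⟩ := hp.exists_tgt_eq hx.symm hj
    exact p.tgt_mem i
  not_prec_inr_inl x y := g.not_prec_inr_inl _ _
  cover z := by
    rcases g.cover z with ⟨z, rfl⟩ | ⟨z, rfl⟩
    · by_cases hz : z ∈ Set.range hp.toFun
      · exact .inl (hz.imp fun _ => congrArg g.inl)
      obtain ⟨i, hi, rfl⟩ := hp.exists_eq_tgt hz
      rw [g.inl_tgt]
      have hr : (b.reverse.tgt i : b.reverse.P.carrier) ∈ Set.range hq.toFun :=
        hq.tgt_mem_range.2 (Set.disjoint_left.1 d.disj hi)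
      exact .inr (hr.imp fun _ => congrArg g.inr)
    · by_cases hz : z ∈ Set.range hq.toFun
      · exact .inr (hz.imp fun _ => congrArg g.inr)
      obtain ⟨i, hi, rfl⟩ := hq.exists_eq_tgt hz
      have hl : (a.tgt i : a.P.carrier) ∈ Set.range hp.toFun :=
        hp.tgt_mem_range.2 (Set.disjoint_right.1 d.disj hi)
      exact .inl (hl.imp fun _ h => (congrArg g.inl h).trans (g.inl_tgt i))
  image_S := by
    rw [← g.image_S]
    exact (Set.image_image g.inl hp.toFun _).symm.trans (congrArg (g.inl '' ·) hp.image_S)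
  image_T := by
    rw [← g.image_T]
    exact (Set.image_image g.inr hq.toFun _).symm.trans (congrArg (g.inr '' ·) hq.image_S)

/-- A subsumption, regarded as a lower part at the identity coface map. -/
def LowerPart.ofSubsumption {p' : IPosetArrow U V} (f : Subsumption p.P p'.P) :
    LowerPart p (Coface.id V) p' where
  toLaxEmbedding := f.toLaxEmbedding
  mem_range_iff z := iff_of_true (f.toEquiv.surjective z) fun _ h => h.elim
  map_tgt := IPosetArrow.map_tgt f.toLaxEmbedding fun _ hx => f.map_T ▸ Set.mem_image_of_mem _ hx
  image_S := f.map_S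

theorem comp_mono {p p' : IPosetArrow U V} {q q' : IPosetArrow V W} (hp : p.P ≤ p'.P)
    (hq : q.P ≤ q'.P) : (p.comp q).P ≤ (p'.comp q').P := by
  obtain ⟨f⟩ := hp
  obtain ⟨g⟩ := reverse_le_reverse hq
  exact (compGluing p q).le ((LowerPart.ofSubsumption f).laxGluing
    (LowerPart.ofSubsumption (p := q.reverse) (p' := q'.reverse) g) (compGluing p' q').toLaxGluing)

theorem comp_congr {p p' : IPosetArrow U V} {q q' : IPosetArrow V W} (hp : p.P ≈ p'.P)
    (hq : q.P ≈ q'.P) : (p.comp q).P ≈ (p'.comp q').P :=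
  equiv_of_le_of_le (comp_mono (le_of_equiv hp) (le_of_equiv hq))
    (comp_mono (le_of_equiv (Setoid.symm hp)) (le_of_equiv (Setoid.symm hq)))

namespace LaxGluing

theorem exists_lift_inl (l : LaxGluing p q R) (g : Gluing a b R)
    (hS : ∀ z, z ∉ b.P.S → ∃ y, y ∉ q.P.S ∧ l.inr y = g.inr z) :
    ∃ e : LaxEmbedding p.P a.P, ∀ x, g.inl (e x) = l.inl x := by
  refine l.inl.exists_lift g.inl g.map_prec_inl fun x => ?_
  rcases g.cover_right (l.inl x) with h | ⟨z, hz, hxz⟩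
  · exact h
  obtain ⟨y, hy, hyz⟩ := hS z hz
  obtain ⟨i, -, rfl⟩ := l.exists_of_inl_eq_inr (hxz.symm.trans hyz.symm)
  exact absurd (q.src_mem i) hy

theorem exists_lift_inr (l : LaxGluing p q R) (g : Gluing a b R)
    (hT : ∀ z, z ∉ a.P.T → ∃ x, x ∉ p.P.T ∧ l.inl x = g.inl z) :
    ∃ e : LaxEmbedding q.P b.P, ∀ y, g.inr (e y) = l.inr y := by
  obtain ⟨e, he⟩ := l.reverse.exists_lift_inl g.reverse hT
  exact ⟨e.reverse, he⟩

variable {e₁ : LaxEmbedding p.P a.P} {e₂ : LaxEmbedding q.P b.P}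

theorem exists_coface (l : LaxGluing p q R) (g : Gluing a b R) (h₁ : ∀ x, g.inl (e₁ x) = l.inl x)
    (h₂ : ∀ y, g.inr (e₂ y) = l.inr y)
    (hT : ∀ z, z ∉ a.P.T → ∃ x, x ∉ p.P.T ∧ l.inl x = g.inl z) :
    ∃ d : Coface V V', (∀ i, e₁ (p.tgt i) = a.tgt (d.emb i)) ∧
      (∀ i, e₂ (q.src i) = b.src (d.emb i)) ∧
      (∀ j, j ∈ d.A ↔ (a.tgt j : a.P.carrier) ∉ Set.range e₁) ∧
      ∀ j, j ∈ d.B ↔ (b.src j : b.P.carrier) ∉ Set.range e₂ := by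
  have he₁T : ∀ i, e₁ (p.tgt i) ∈ a.P.T := fun i => by
    by_contra h
    obtain ⟨x, hx, hxi⟩ := hT _ h
    rw [h₁] at hxi
    exact hx (l.inl.injective hxi ▸ p.tgt_mem i)
  obtain ⟨m, hm, hlab⟩ := exists_orderEmbedding_tgt e₁ he₁T
  have hm' : ∀ i, e₂ (q.src i) = b.src (m i) := fun i => g.inr.injective (by
    rw [h₂, ← l.inl_tgt, ← h₁, hm, g.inl_tgt])
  refine ⟨⟨m, {j | (a.tgt j : a.P.carrier) ∉ Set.range e₁},
    {j | (b.src j : b.P.carrier) ∉ Set.range e₂}, hlab, ?_, ?_⟩, hm, hm', fun _ => Iff.rfl,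
    fun _ => Iff.rfl⟩
  · refine Set.disjoint_left.2 fun j hA hB => ?_
    rcases l.cover (g.inl (a.tgt j)) with ⟨x, hx⟩ | ⟨y, hy⟩
    · exact hA ⟨x, g.inl.injective ((h₁ x).trans hx)⟩
    · exact hB ⟨y, g.inr.injective ((h₂ y).trans (hy.trans (g.inl_tgt j)))⟩
  · ext j
    rw [Set.mem_compl_iff, Set.mem_union, Set.mem_ofPred_eq, Set.mem_ofPred_eq, ← not_and_or,
      not_iff_not]
    constructor
    · rintro ⟨⟨x, hx⟩, y, hy⟩
      have hxy : l.inl x = l.inr y := by rw [← h₁, ← h₂, hx, hy, g.inl_tgt]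
      obtain ⟨i, rfl, -⟩ := l.exists_of_inl_eq_inr hxy
      exact ⟨i, a.tgt_coe_injective ((hm i).symm.trans hx)⟩
    · rintro ⟨i, rfl⟩
      exact ⟨⟨_, hm i⟩, _, hm' i⟩

theorem nonempty_lowerPart (l : LaxGluing p q R) (g : Gluing a b R)
    (h₁ : ∀ x, g.inl (e₁ x) = l.inl x)
    (hT : ∀ z, z ∉ a.P.T → ∃ x, x ∉ p.P.T ∧ l.inl x = g.inl z)
    (hemb : ∀ i, e₁ (p.tgt i) = a.tgt (d.emb i))
    (hA : ∀ j, j ∈ d.A ↔ (a.tgt j : a.P.carrier) ∉ Set.range e₁) : Nonempty (LowerPart p d a) := by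
  refine ⟨⟨e₁, fun z => ⟨?_, fun h => ?_⟩, hemb, ?_⟩⟩
  · rintro hz i hi rfl
    exact (hA i).1 hi hz
  · by_cases hz : z ∈ a.P.T
    · obtain ⟨j, rfl⟩ := a.exists_tgt_eq hz
      exact not_not.1 fun hj => h j ((hA j).2 hj) rfl
    · obtain ⟨x, -, hx⟩ := hT z hz
      exact ⟨x, g.inl.injective ((h₁ x).trans hx)⟩
  · refine g.inl.injective.image_injective ?_
    rw [g.image_S, ← l.image_S, Set.image_image]
    exact Set.image_congr fun x _ => h₁ x

theorem exists_parts (l : LaxGluing p q R) (g : Gluing a b R)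
    (hT : ∀ z, z ∉ a.P.T → ∃ x, x ∉ p.P.T ∧ l.inl x = g.inl z)
    (hS : ∀ z, z ∉ b.P.S → ∃ y, y ∉ q.P.S ∧ l.inr y = g.inr z) :
    ∃ d : Coface V V', Nonempty (LowerPart p d a) ∧ Nonempty (UpperPart q d b) := by
  obtain ⟨e₁, h₁⟩ := l.exists_lift_inl g hS
  obtain ⟨e₂, h₂⟩ := l.exists_lift_inr g hT
  obtain ⟨d, hd₁, hd₂, hA, hB⟩ := l.exists_coface g h₁ h₂ hT
  exact ⟨d, l.nonempty_lowerPart g h₁ hT hd₁ hA,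
    l.reverse.nonempty_lowerPart (d := d.swap) (e₁ := e₂.reverse) g.reverse h₂ hS hd₂ hB⟩

end LaxGluing

end IPosetArrow

/-! ### Automata on iposets -/

open IPosetArrow

/-- An automaton whose nodes carry lo-sets and whose edges carry iposets, each of them without
events that are both started and terminated by the edge. Hence a cut of an iposet composed of edges
can always be moved to a node. -/
structure STAutomaton (Act : Type u) where
  Node : Type v
  ob : Node → LoSet Act
  edge : ∀ x y, IPosetArrow (ob x) (ob y) → Prop
  src_or_tgt : ∀ {x y e}, edge x y e → e.P.S = Set.univ ∨ e.P.T = Set.univ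
  start : Set Node
  accept : Set Node

namespace STAutomaton

/-- `G.Run x y q`: there is a run from `x` to `y` whose edges compose to `q`. -/
inductive Run (G : STAutomaton.{u, v} Act) :
    ∀ x y, IPosetArrow (G.ob x) (G.ob y) → Prop
  | nil (x : G.Node) : Run G x x (IPosetArrow.id (G.ob x))
  | cons {x y z : G.Node} {e : IPosetArrow (G.ob x) (G.ob y)} {q : IPosetArrow (G.ob y) (G.ob z)} :
      G.edge x y e → Run G y z q → Run G x z (e.comp q)

variable {G : STAutomaton.{u, v} Act} {x y z : G.Node} {U V W : LoSet Act}

theorem Run.exists_split {r : IPosetArrow (G.ob x) (G.ob y)} (h : G.Run x y r)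
    (D Z : Set r.P.carrier) (hDZ : ∀ u v, r.P.prec u v → v ∉ Z → u ∈ D) :
    ∃ z a b, G.Run x z a ∧ G.Run z y b ∧ ∃ g : Gluing a b r.P,
      (∀ u, u ∉ a.P.T → g.inl u ∈ D) ∧ ∀ u, u ∉ b.P.S → g.inr u ∈ Z := by
  induction h with
  | nil x =>
    exact ⟨x, _, _, .nil x, .nil x, idGluing _, fun _ h => absurd trivial h,
      fun _ h => absurd trivial h⟩
  | @cons x y z e q he hq ih =>
    let k := compGluing e q
    by_cases hD : ∀ u, u ∉ e.P.T → k.inl u ∈ D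
    · obtain ⟨w, a, b, ha, hb, g, hgD, hgZ⟩ := ih {u | k.inr u ∈ D} {u | k.inr u ∈ Z}
        fun u v huv hv => hDZ _ _ (k.map_prec_inr _ _ huv) hv
      obtain ⟨g', hl, hm, hr⟩ := k.exists_assoc g
      refine ⟨w, _, b, .cons he ha, hb, g', fun u hu => ?_, fun u hu => hr u ▸ hgZ u hu⟩
      rcases (compGluing e a).cover_left u with ⟨u, rfl⟩ | ⟨u, hu', rfl⟩
      · exact hm u ▸ hgD u fun h => hu ((compGluing e a).inr_mem_T.2 h)
      · exact hl u ▸ hD u hu'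
    · push Not at hD
      obtain ⟨v, hv, hvD⟩ := hD
      have hS : e.P.S = Set.univ :=
        (G.src_or_tgt he).resolve_right fun h => hv (h ▸ Set.mem_univ v)
      refine ⟨x, _, _, .nil x, .cons he hq, idGluing _, fun _ h => absurd trivial h,
        fun u hu => ?_⟩
      rcases k.cover_right u with ⟨u, rfl⟩ | ⟨u, hu', rfl⟩
      · exact absurd (k.inl_mem_S.2 (hS ▸ Set.mem_univ u)) hu
      · by_contra h
        exact hvD (hDZ _ _ (k.prec_inl_inr _ _ hv hu') h)

theorem Run.exists_append {p : IPosetArrow (G.ob x) (G.ob y)} {q : IPosetArrow (G.ob y) (G.ob z)}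
    (hp : G.Run x y p) (hq : G.Run y z q) : ∃ r, G.Run x z r ∧ r.P ≈ (p.comp q).P := by
  induction hp with
  | nil x => exact ⟨q, hq, Setoid.symm (id_comp q)⟩
  | cons he _ ih =>
    obtain ⟨r, hr, e⟩ := ih hq
    exact ⟨_, .cons he hr,
      Setoid.trans (comp_congr (Setoid.refl _) e) (Setoid.symm (comp_assoc _ _ _))⟩

variable (G)

/-- The iposets subsumed by the composite of an accepting run. -/
def Accepts (P : IPoset Act) : Prop :=
  ∃ x ∈ G.start, ∃ y ∈ G.accept, ∃ r, G.Run x y r ∧ P ≤ r.P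

/-- The positions at which a run may be when `p` has occurred: nodes together with the coface map
telling which of their events are not present in `p` (or not present after `p`). -/
def reach (p : IPosetArrow U V) : Set (Σ z : G.Node, Coface V (G.ob z)) :=
  {c | ∃ x ∈ G.start, ∃ a, G.Run x c.1 a ∧ Nonempty (LowerPart p c.2 a)}

theorem accepts_comp_iff (p : IPosetArrow U V) (q : IPosetArrow V W) :
    G.Accepts (p.comp q).P ↔ ∃ c ∈ G.reach p, ∃ y ∈ G.accept, ∃ b,
      G.Run c.1 y b ∧ Nonempty (UpperPart q c.2 b) := by
  constructor
  · rintro ⟨x, hx, y, hy, r, hr, ⟨f⟩⟩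
    let l := (compGluing p q).toLaxGluing.trans f
    obtain ⟨z, a, b, ha, hb, g, hD, hZ⟩ := hr.exists_split {c | ∃ x, x ∉ p.P.T ∧ l.inl x = c}
      {c | ∃ y, y ∉ q.P.S ∧ l.inr y = c} fun u v huv hv => by
        obtain ⟨v, rfl⟩ := (l.cover_right v).resolve_right hv
        obtain ⟨u, rfl⟩ | hu := l.cover_left u
        exacts [absurd huv (l.not_prec_inr_inl _ _), hu]
    obtain ⟨d, hp, hq⟩ := l.exists_parts g hD hZ
    exact ⟨⟨z, d⟩, ⟨x, hx, a, ha, hp⟩, y, hy, b, hb, hq⟩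
  · rintro ⟨c, ⟨x, hx, a, ha, ⟨hp⟩⟩, y, hy, b, hb, ⟨hq⟩⟩
    obtain ⟨r, hr, e⟩ := ha.exists_append hb
    refine ⟨x, hx, y, hy, r, hr, ?_⟩
    calc
      (p.comp q).P ≤ (a.comp b).P :=
        (compGluing p q).le (hp.laxGluing hq (compGluing a b).toLaxGluing)
      _ ≤ r.P := IPoset.le_of_equiv (Setoid.symm e)

end STAutomaton

/-! ### The automaton of the Kleene plus -/

namespace IPoset

variable {P Q : IPoset Act}

theorem exists_loSet (A : Set P.carrier) (hA : ∀ x ∈ A, ∀ y ∈ A, ¬ P.prec x y) :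
    ∃ (U : LoSet Act) (e : Fin U.n ≃ A), (∀ i j, i < j ↔ P.evo (e i) (e j)) ∧
      ∀ i, P.lab (e i) = U.lab i := by
  classical
  have : IsStrictTotalOrder A fun x y => P.evo x y :=
    { trichotomous := fun x y h₁ h₂ => by
        rcases P.comparable x y with h | h | h | h | h
        · exact Subtype.ext h
        · exact absurd h (hA _ x.2 _ y.2)
        · exact absurd h (hA _ y.2 _ x.2)
        · exact absurd h h₁
        · exact absurd h h₂
      irrefl := fun x => P.evo_irrefl _
      trans := fun x y z => P.evo_trans _ _ _ }
  let _ : LinearOrder A := linearOrderOfSTO fun x y => P.evo x y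
  let _ := Fintype.ofFinite A
  let e := Fintype.orderIsoFinOfCardEq A rfl
  exact ⟨⟨_, fun i => P.lab (e i)⟩, e.toEquiv, fun _ _ => e.lt_iff_lt.symm, fun _ => rfl⟩

variable (P) in
theorem exists_loSet_S : ∃ (U : LoSet Act) (e : Fin U.n ≃ P.S),
    (∀ i j, i < j ↔ P.evo (e i) (e j)) ∧ ∀ i, P.lab (e i) = U.lab i :=
  exists_loSet P.S fun x _ y hy => P.S_minimal y hy x

variable (P) in
theorem exists_loSet_T : ∃ (U : LoSet Act) (e : Fin U.n ≃ P.T),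
    (∀ i j, i < j ↔ P.evo (e i) (e j)) ∧ ∀ i, P.lab (e i) = U.lab i :=
  P.reverse.exists_loSet_S

theorem exists_comp_eq_glue (f : InterfaceIso P Q) :
    ∃ (U V W : LoSet Act) (p : IPosetArrow U V) (q : IPosetArrow V W), p.P = P ∧ q.P = Q ∧
      (p.comp q).P = glue P Q f := by
  obtain ⟨U, s, hs, hs'⟩ := P.exists_loSet_S
  obtain ⟨V, t, ht, ht'⟩ := P.exists_loSet_T
  obtain ⟨W, t', ht₁, ht₂⟩ := Q.exists_loSet_T
  refine ⟨U, V, W, ⟨P, s, hs, hs', t, ht, ht'⟩, ⟨Q, t.trans f.toEquiv,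
    fun i j => (ht i j).trans (f.evo_iff _ _), fun i => (f.lab_eq _).trans (ht' i),
    t', ht₁, ht₂⟩, rfl, rfl, ?_⟩
  have : f = ⟨t.symm.trans (t.trans f.toEquiv), by simpa using f.evo_iff,
      by simpa using f.lab_eq⟩ := by
    obtain ⟨f, _, _⟩ := f
    congr
    ext
    simp
  exact congrArg (glue P Q) this.symm

end IPoset

namespace IpomsetLanguage

variable {L : IpomsetLanguage Act} {U V W : LoSet Act}

theorem mk_mem_congr {P Q : IPoset Act} (h : P ≈ Q) :
    Ipomset.mk P ∈ L.carrier ↔ Ipomset.mk Q ∈ L.carrier := by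
  have : Ipomset.mk P = Ipomset.mk Q := Quotient.sound h
  rw [this]

theorem mk_mem_of_le {P Q : IPoset Act} (hP : P.IsInterval) (h : P ≤ Q)
    (hQ : Ipomset.mk Q ∈ L.carrier) : Ipomset.mk P ∈ L.carrier :=
  L.down_closed _ _ hP (show (Ipomset.mk P).Subsumed (Ipomset.mk Q) from h) hQ

theorem mk_comp_mem_glue {M : IpomsetLanguage Act} {p : IPosetArrow U V} {q : IPosetArrow V W}
    (hp : Ipomset.mk p.P ∈ L.carrier) (hq : Ipomset.mk q.P ∈ M.carrier) :
    Ipomset.mk (p.comp q).P ∈ (L.glue M).carrier :=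
  ⟨(compGluing p q).isInterval (L.interval _ hp) (M.interval _ hq),
    _, ⟨p.P, q.P, p.interfaceIso q, hp, hq, rfl⟩, le_refl (p.comp q).P⟩

end IpomsetLanguage

namespace STAutomaton

variable (G : STAutomaton.{u, v} Act)

/-- `G` recognises `L` if the iposets of `L` are the interval iposets accepted by `G`. -/
def Recognises (L : IpomsetLanguage Act) : Prop :=
  ∀ P, Ipomset.mk P ∈ L.carrier ↔ P.IsInterval ∧ G.Accepts P

/-- The automaton `G` with additional identity edges from its accept nodes to its start nodes. -/
def loop : STAutomaton.{u, v} Act where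
  Node := G.Node
  ob := G.ob
  edge x y e := G.edge x y e ∨ x ∈ G.accept ∧ y ∈ G.start ∧ e.P = (IPosetArrow.id (G.ob x)).P
  src_or_tgt := by
    rintro x y e (h | ⟨-, -, h⟩)
    · exact G.src_or_tgt h
    · exact .inl (h ▸ rfl)
  start := G.start
  accept := G.accept

variable {G} {L : IpomsetLanguage Act} {x y z : G.Node}

theorem Run.isInterval {r : IPosetArrow (G.ob x) (G.ob y)} (h : G.Run x y r) :
    r.P.IsInterval := by
  have of_not_prec {P : IPoset Act} (h : ∀ x y, ¬ P.prec x y) : P.IsInterval :=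
    ⟨0, 0, fun _ => le_rfl, fun x y => iff_of_false (h x y) (lt_irrefl _)⟩
  induction h with
  | nil x => exact of_not_prec fun _ _ h => h
  | @cons x y z e q he _ ih =>
    refine (compGluing _ _).isInterval (of_not_prec fun u v => ?_) ih
    rcases G.src_or_tgt he with h | h
    · exact e.P.S_minimal _ (h ▸ Set.mem_univ v) u
    · exact e.P.T_maximal _ (h ▸ Set.mem_univ u) v

theorem Run.loop {r : IPosetArrow (G.ob x) (G.ob y)} (h : G.Run x y r) : G.loop.Run x y r := by
  induction h with
  | nil x => exact .nil (G := G.loop) x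
  | cons he _ ih => exact .cons (G := G.loop) (.inl he) ih

theorem Recognises.mk_mem_of_run {r : IPosetArrow (G.ob x) (G.ob y)} (hG : G.Recognises L)
    (hx : x ∈ G.start) (hy : y ∈ G.accept) (h : G.Run x y r) : Ipomset.mk r.P ∈ L.carrier :=
  (hG r.P).2 ⟨h.isInterval, x, hx, y, hy, r, h, le_rfl⟩

theorem comp_equiv_of_eq_id {U V W : LoSet Act} {e : IPosetArrow U V}
    (he : e.P = (IPosetArrow.id U).P) (q : IPosetArrow V W) : (e.comp q).P ≈ q.P := by
  obtain rfl := tgt_eq_of_le he.le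
  exact Setoid.trans (comp_congr (he ▸ Setoid.refl _) (Setoid.refl _)) (id_comp q)

theorem loop_accepts_of_mem_powSucc (hG : G.Recognises L) (n : ℕ) :
    ∀ P, Ipomset.mk P ∈ (L.powSucc n).carrier → G.loop.Accepts P := by
  induction n with
  | zero =>
    intro P hP
    obtain ⟨x, hx, y, hy, r, hr, h⟩ := ((hG P).1 hP).2
    exact ⟨x, hx, y, hy, r, hr.loop, h⟩
  | succ n ih =>
    rintro P ⟨-, _, ⟨P₁, P₂, f, h₁, h₂, rfl⟩, hP : P ≤ IPoset.glue P₁ P₂ f⟩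
    obtain ⟨U, V, W, p, q, rfl, rfl, hpq⟩ := IPoset.exists_comp_eq_glue f
    obtain ⟨x, hx, y, hy, r, hr, hpr⟩ := ((hG _).1 h₁).2
    obtain ⟨y', hy', z, hz, s, hs, hqs⟩ := ih _ h₂
    obtain rfl := src_eq_of_le hpr
    obtain rfl := tgt_eq_of_le hqs
    have hyy' : G.ob y' = G.ob y := (src_eq_of_le hqs).symm.trans (tgt_eq_of_le hpr)
    obtain ⟨e, he⟩ : ∃ e : IPosetArrow (G.ob y) (G.ob y'), e.P = (IPosetArrow.id (G.ob y)).P :=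
      hyy' ▸ ⟨_, rfl⟩
    obtain rfl := tgt_eq_of_le hpr
    obtain ⟨t, ht, htrs⟩ :=
      hr.loop.exists_append (Run.cons (G := G.loop) (.inr ⟨hy, hy', he⟩) hs)
    refine ⟨x, hx, z, hz, t, ht, ?_⟩
    calc
      P ≤ (p.comp q).P := hpq ▸ hP
      _ ≤ (r.comp (e.comp s)).P := comp_mono hpr
        (hqs.trans (IPoset.le_of_equiv (Setoid.symm (comp_equiv_of_eq_id he s))))
      _ ≤ t.P := IPoset.le_of_equiv (Setoid.symm htrs)

/- The accumulator `a` is the part of the run since the last restart. -/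
theorem exists_mk_comp_mem_powSucc (hG : G.Recognises L) {y z : G.loop.Node}
    {q : IPosetArrow (G.loop.ob y) (G.loop.ob z)} (hq : G.loop.Run y z q) (hz : z ∈ G.accept) :
    ∀ {x : G.Node} {a : IPosetArrow (G.ob x) (G.ob y)}, x ∈ G.start → G.Run x y a →
      ∃ n, Ipomset.mk (a.comp q).P ∈ (L.powSucc n).carrier := by
  induction hq with
  | nil z =>
    intro x a hx ha
    exact ⟨0, (IpomsetLanguage.mk_mem_congr (comp_id a)).2 (hG.mk_mem_of_run hx hz ha)⟩
  | @cons y y' z e q he _ ih =>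
    intro x a hx ha
    rcases he with he | ⟨hy, hy', he⟩
    · obtain ⟨a', ha', haa'⟩ := ha.exists_append (.cons he (.nil (G := G) _))
      obtain ⟨n, hn⟩ := ih hz hx ha'
      refine ⟨n, (IpomsetLanguage.mk_mem_congr ?_).2 hn⟩
      calc
        (a.comp (e.comp q)).P ≈ ((a.comp e).comp q).P := Setoid.symm (comp_assoc _ _ _)
        _ ≈ ((a.comp (e.comp (IPosetArrow.id _))).comp q).P :=
          comp_congr (comp_congr (Setoid.refl _) (Setoid.symm (comp_id e))) (Setoid.refl _)
        _ ≈ (a'.comp q).P := comp_congr (Setoid.symm haa') (Setoid.refl _)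
    · obtain ⟨n, hn⟩ := ih hz hy' (.nil (G := G) y')
      refine ⟨n + 1, IpomsetLanguage.mk_comp_mem_glue (hG.mk_mem_of_run hx hy ha) ?_⟩
      refine (IpomsetLanguage.mk_mem_congr ?_).2 hn
      exact Setoid.trans (comp_equiv_of_eq_id he q) (Setoid.symm (id_comp q))

theorem Recognises.loop (hG : G.Recognises L) : G.loop.Recognises L.kleenePlus := by
  refine fun P => ⟨fun h => ?_, ?_⟩
  · obtain ⟨n, hn⟩ := Set.mem_iUnion.1 h
    exact ⟨L.kleenePlus.interval _ h, loop_accepts_of_mem_powSucc hG n P hn⟩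
  · rintro ⟨hP, x, hx, z, hz, r, hr, hPr⟩
    obtain ⟨n, hn⟩ := exists_mk_comp_mem_powSucc hG hr hz hx (.nil (G := G) x)
    have hr : Ipomset.mk r.P ∈ (L.powSucc n).carrier :=
      (IpomsetLanguage.mk_mem_congr (id_comp r)).1 hn
    exact Set.mem_iUnion.2 ⟨n, (L.powSucc n).mk_mem_of_le hP hPr hr⟩

end STAutomaton

section Cells

variable {C : Type v} [Category.{w} C] (F : C ⥤ LoSet Act) (X : Cᵒᵖ ⥤ Type w')
  (start accept : ∀ U : C, Set (X.obj (op U)))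

/-- The common form of `HDA.lang` and `IHDA.lang`. -/
def pathLang : Set (Ipomset Act) :=
  {P | ∃ (U V : C) (x : X.obj (op U)) (y : X.obj (op V)) (p : Path F X x y),
    x ∈ start U ∧ y ∈ accept V ∧ P = Ipomset.mk p.ev.P}

/-- The single steps of paths, with their iposets. -/
inductive CellStep : ∀ x y : (Σ U : C, X.obj (op U)), IPosetArrow (F.obj x.1) (F.obj y.1) → Prop
  | up {x y} (d : x.1 ⟶ y.1) : (F.map d : Coface _ _).B = ∅ → X.map d.op y.2 = x.2 →
      CellStep x y (starter (F.map d))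
  | down {x y} (d : y.1 ⟶ x.1) : (F.map d : Coface _ _).A = ∅ → X.map d.op x.2 = y.2 →
      CellStep x y (terminator (F.map d))

/-- The automaton whose nodes are the cells of `X` and whose runs are the paths in `X`. -/
def cellAutomaton : STAutomaton.{u, max v w'} Act where
  Node := Σ U : C, X.obj (op U)
  ob c := F.obj c.1
  edge := CellStep F X
  src_or_tgt := by
    rintro _ _ _ (_ | _)
    exacts [.inr rfl, .inl rfl]
  start := {x | x.2 ∈ start x.1}
  accept := {x | x.2 ∈ accept x.1}

variable {F X start accept}

theorem Path.run_ev {U V : C} {x : X.obj (op U)} {y : X.obj (op V)} (p : Path F X x y) :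
    (cellAutomaton F X start accept).Run ⟨U, x⟩ ⟨V, y⟩ p.ev := by
  induction p with
  | nil x => exact .nil (G := cellAutomaton F X start accept) _
  | @up U V _ x y _ d hB hx _ ih =>
    exact .cons (G := cellAutomaton F X start accept)
      (CellStep.up (x := ⟨U, x⟩) (y := ⟨V, y⟩) d hB hx) ih
  | @down U V _ x y _ d hA hx _ ih =>
    exact .cons (G := cellAutomaton F X start accept)
      (CellStep.down (x := ⟨U, x⟩) (y := ⟨V, y⟩) d hA hx) ih

theorem exists_ev_eq_of_run {x y : (cellAutomaton F X start accept).Node}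
    {r : IPosetArrow ((cellAutomaton F X start accept).ob x)
      ((cellAutomaton F X start accept).ob y)}
    (h : (cellAutomaton F X start accept).Run x y r) : ∃ p : Path F X x.2 y.2, p.ev = r := by
  induction h with
  | nil x => exact ⟨.nil _, rfl⟩
  | cons he _ ih =>
    obtain ⟨p, rfl⟩ := ih
    rcases he with ⟨d, hB, hx⟩ | ⟨d, hA, hx⟩
    exacts [⟨.up d hB hx p, rfl⟩, ⟨.down d hA hx p, rfl⟩]

theorem Path.isInterval_ev {U V : C} {x : X.obj (op U)} {y : X.obj (op V)} (p : Path F X x y) :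
    p.ev.P.IsInterval :=
  (p.run_ev (start := fun _ => ∅) (accept := fun _ => ∅)).isInterval

theorem cellAutomaton_recognises {L : IpomsetLanguage Act}
    (hL : L.carrier = pathLang F X start accept) :
    (cellAutomaton F X start accept).Recognises L := by
  refine fun P => ⟨fun hP => ⟨L.interval _ hP, ?_⟩, ?_⟩
  · obtain ⟨U, V, x, y, p, hx, hy, h⟩ : Ipomset.mk P ∈ pathLang F X start accept := hL ▸ hP
    exact ⟨⟨U, x⟩, hx, ⟨V, y⟩, hy, p.ev, p.run_ev, IPoset.le_of_equiv (Quotient.exact h)⟩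
  · rintro ⟨hP, x, hx, y, hy, r, hr, hPr⟩
    obtain ⟨p, rfl⟩ := exists_ev_eq_of_run hr
    exact L.mk_mem_of_le hP hPr (hL ▸ ⟨_, _, _, _, p, hx, hy, rfl⟩)

end Cells

/-! ### Faces of iposets -/

theorem Coface.emb_notMem_A {U V : LoSet Act} (d : Coface U V) (j : Fin U.n) : d.emb j ∉ d.A :=
  fun h => d.union.le (.inl h) ⟨j, rfl⟩

theorem Coface.emb_notMem_B {U V : LoSet Act} (d : Coface U V) (j : Fin U.n) : d.emb j ∉ d.B :=
  fun h => d.union.le (.inr h) ⟨j, rfl⟩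

namespace IPosetArrow

open IPoset

variable {U U' U'' V V' V'' : LoSet Act}

/-- A lower part of a lower part. -/
def LowerPart.trans {r : IPosetArrow U'' V''} {q : IPosetArrow U' V'} {p : IPosetArrow U V}
    {b : Coface V'' V'} {d : Coface V' V} (g : LowerPart r b q) (f : LowerPart q d p) :
    LowerPart r (b.comp d) p where
  toLaxEmbedding := g.toLaxEmbedding.trans f.toLaxEmbedding
  mem_range_iff z := by
    constructor
    · rintro ⟨x, rfl⟩ _ (⟨j, hj, rfl⟩ | hi)
      · intro h
        exact (g.mem_range_iff _).1 ⟨x, rfl⟩ j hj (f.injective (h.trans (f.map_tgt j).symm))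
      · exact (f.mem_range_iff _).1 ⟨_, rfl⟩ _ hi
    · intro h
      obtain ⟨y, rfl⟩ := (f.mem_range_iff z).2 fun i hi => h i (.inr hi)
      obtain ⟨x, rfl⟩ := (g.mem_range_iff y).2 fun j hj hy =>
        h (d.emb j) (.inl ⟨j, hj, rfl⟩) (hy ▸ f.map_tgt j)
      exact ⟨x, rfl⟩
  map_tgt i := (congrArg f.toFun (g.map_tgt i)).trans (f.map_tgt _)
  image_S := by
    rw [← f.image_S, ← g.image_S, Set.image_image]
    rfl

/-- `q` is the face of `p` along `d`: the target events unstarted by `d` are removed, and those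
terminated by `d` leave the target interface. -/
def IsFace (q : IPosetArrow U V') (d : Coface V' V) (p : IPosetArrow U V) : Prop :=
  ∃ f : LowerPart q d p, ∀ x y, q.P.prec x y → p.P.prec (f.toFun x) (f.toFun y)

theorem isFace_id_iff {q : IPosetArrow U V} {p : IPosetArrow U V} :
    IsFace q (Coface.id V) p ↔ q.P ≈ p.P := by
  constructor
  · rintro ⟨f, hf⟩
    refine f.equiv_of_surjective (fun z => (f.mem_range_iff z).2 fun _ h => h.elim) f.image_S ?_ hf
    ext z
    constructor
    · rintro ⟨x, hx, rfl⟩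
      obtain ⟨i, rfl⟩ := q.exists_tgt_eq hx
      exact f.map_tgt i ▸ p.tgt_mem i
    · intro hz
      obtain ⟨i, rfl⟩ := p.exists_tgt_eq hz
      exact ⟨q.tgt i, q.tgt_mem i, f.map_tgt i⟩
  · rintro ⟨f⟩
    exact ⟨LowerPart.ofSubsumption f.toSubsumption, f.map_prec⟩

namespace IsFace

variable {r : IPosetArrow U V''} {q : IPosetArrow U V'} {p : IPosetArrow U V}
  {b : Coface V'' V'} {d : Coface V' V}

theorem trans (hr : IsFace r b q) (hq : IsFace q d p) : IsFace r (b.comp d) p := by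
  obtain ⟨g, hg⟩ := hr
  obtain ⟨f, hf⟩ := hq
  exact ⟨g.trans f, fun x y h => hf _ _ (hg _ _ h)⟩

theorem lift (hr : IsFace r (b.comp d) p) (hq : IsFace q d p) : IsFace r b q := by
  obtain ⟨h, hh⟩ := hr
  obtain ⟨f, hf⟩ := hq
  obtain ⟨e, he⟩ := h.toLaxEmbedding.exists_lift f.toLaxEmbedding hf fun x =>
    (f.mem_range_iff _).2 fun i hi => (h.mem_range_iff _).1 ⟨x, rfl⟩ i (.inr hi)
  refine ⟨⟨e, fun z => ?_, fun i => f.injective ?_, f.injective.image_injective ?_⟩,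
    fun x y hxy => f.reflect_prec _ _ ?_⟩
  · constructor
    · rintro ⟨x, rfl⟩ j hj hx
      refine (h.mem_range_iff _).1 ⟨x, rfl⟩ (d.emb j) (.inl ⟨j, hj, rfl⟩) ?_
      rw [← f.map_tgt, ← hx]
      exact (he x).symm
    · intro hz
      obtain ⟨x, hx⟩ : f.toFun z ∈ Set.range h.toFun := by
        refine (h.mem_range_iff _).2 ?_
        rintro _ (⟨j, hj, rfl⟩ | hi)
        · rw [← f.map_tgt]
          exact fun h => hz j hj (f.injective h)
        · exact (f.mem_range_iff _).1 ⟨z, rfl⟩ _ hi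
      exact ⟨x, f.injective ((he x).trans hx)⟩
  · exact (he _).trans ((h.map_tgt i).trans (f.map_tgt _).symm)
  · rw [f.image_S, ← h.image_S, Set.image_image]
    exact Set.image_congr fun x _ => he x
  · exact (congrArg₂ p.P.prec (he x) (he y)).mpr (hh x y hxy)

theorem equiv {q' : IPosetArrow U V'} (hq : IsFace q d p)
    (hq' : IsFace q' d p) : q.P ≈ q'.P := by
  rw [← d.id_comp] at hq
  exact isFace_id_iff.1 (hq.lift hq')

theorem tgt_notMem_S (hq : IsFace q d p) {i : Fin V.n} (hi : i ∈ d.A) :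
    (p.tgt i : p.P.carrier) ∉ p.P.S := by
  obtain ⟨f, -⟩ := hq
  rw [← f.image_S]
  rintro ⟨x, -, hx⟩
  exact (f.mem_range_iff _).1 ⟨x, hx⟩ i hi rfl

theorem isInterval (hq : IsFace q d p) (hp : p.P.IsInterval) : q.P.IsInterval := by
  obtain ⟨f, hf⟩ := hq
  obtain ⟨b, e, hbe, h⟩ := hp
  exact ⟨fun x => b (f.toFun x), fun x => e (f.toFun x), fun x => hbe _, fun x y =>
    ⟨fun hxy => (h _ _).1 (hf x y hxy), fun hxy => f.reflect_prec x y ((h _ _).2 hxy)⟩⟩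

end IsFace

/-- The face of `p` along `d`, which exists if `d` unstarts no source event. -/
noncomputable def face (p : IPosetArrow U V) (d : Coface V' V)
    (h : ∀ i ∈ d.A, (p.tgt i : p.P.carrier) ∉ p.P.S) : IPosetArrow U V' where
  P :=
    { carrier := {x : p.P.carrier // ∀ i ∈ d.A, x ≠ p.tgt i}
      finite := inferInstance
      prec x y := p.P.prec x y
      evo x y := p.P.evo x y
      S := {x | x.1 ∈ p.P.S}
      T := Set.range fun j => ⟨p.tgt (d.emb j), fun i hi hij =>
        d.emb_notMem_A j (p.tgt_coe_injective hij ▸ hi)⟩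
      lab x := p.P.lab x
      prec_irrefl x := p.P.prec_irrefl x
      prec_trans x y z := p.P.prec_trans x y z
      evo_irrefl x := p.P.evo_irrefl x
      evo_trans x y z := p.P.evo_trans x y z
      comparable x y := (p.P.comparable x y).imp_left Subtype.ext
      S_minimal x hx y := p.P.S_minimal x hx y
      T_maximal := by
        rintro _ ⟨j, rfl⟩ y
        exact p.P.T_maximal _ (p.tgt_mem _) _ }
  src := Equiv.ofBijective
    (fun i => ⟨⟨p.src i, fun j hj hij => h j hj (hij ▸ p.src_mem i)⟩, p.src_mem i⟩)
    ⟨fun i j hij => p.src_coe_injective (congrArg (fun x => x.1.1) hij), by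
      rintro ⟨⟨x, hx⟩, hxS⟩
      obtain ⟨i, rfl⟩ := p.exists_src_eq hxS
      exact ⟨i, rfl⟩⟩
  src_evo := p.src_evo
  src_lab := p.src_lab
  tgt := Equiv.ofInjective _ fun i j hij =>
    d.emb.injective (p.tgt_coe_injective (congrArg (fun x => x.1) hij))
  tgt_evo i j := d.emb.lt_iff_lt.symm.trans (p.tgt_evo _ _)
  tgt_lab i := (p.tgt_lab _).trans (d.lab i)

theorem isFace_face (p : IPosetArrow U V) (d : Coface V' V)
    (h : ∀ i ∈ d.A, (p.tgt i : p.P.carrier) ∉ p.P.S) : IsFace (p.face d h) d p :=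
  ⟨{  toFun := Subtype.val
      injective := Subtype.val_injective
      map_lab := fun _ => rfl
      reflect_prec := fun _ _ h => h
      map_evo := fun _ _ h _ _ => h
      mem_range_iff := fun z => ⟨by rintro ⟨x, rfl⟩; exact x.2, fun hz => ⟨⟨z, hz⟩, rfl⟩⟩
      map_tgt := fun _ => rfl
      image_S := (Set.image_preimage_eq_inter_range (f := Subtype.val) (t := p.P.S)).trans <|
        Set.inter_eq_left.2 fun x hx => ⟨⟨x, fun i hi hxi => h i hi (hxi ▸ hx)⟩, rfl⟩ },
    fun _ _ h => h⟩

theorem IsFace.exists_of_comp {r : IPosetArrow U V''} {p : IPosetArrow U V} {b : Coface V'' V'}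
    {d : Coface V' V} (hr : IsFace r (b.comp d) p) :
    ∃ q : IPosetArrow U V', IsFace q d p ∧ IsFace r b q :=
  have hq := p.isFace_face d fun _ hi => hr.tgt_notMem_S (.inr hi)
  ⟨_, hq, hr.lift hq⟩

theorem isFace_comp_starter (p : IPosetArrow U V') {d : Coface V' V} (hB : d.B = ∅) :
    IsFace p d (p.comp (starter d)) := by
  let g := compGluing p (starter d)
  have hg : ∀ i : Fin V.n, g.inr i = (p.comp (starter d)).tgt i := fun i => rfl
  refine ⟨⟨g.inl, fun z => ⟨?_, fun h => ?_⟩, fun i => g.inl_tgt i, g.image_S⟩, g.map_prec_inl⟩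
  · rintro ⟨x, rfl⟩ i hi h
    obtain ⟨j, -, hj⟩ := g.exists_of_inl_eq_inr (h.trans (hg i).symm)
    exact d.emb_notMem_A j ((show d.emb j = i from hj) ▸ hi)
  · refine (g.cover_right z).resolve_right ?_
    rintro ⟨i, hi, rfl⟩
    have hA : i ∈ d.A := (d.union.ge hi).resolve_right (hB ▸ Set.notMem_empty i)
    exact h i hA (hg i)

/-- The inclusion of the target interface. -/
def tgtEmbedding (p : IPosetArrow U V) : LaxEmbedding (id V).P p.P where
  toFun i := p.tgt i
  injective := p.tgt_coe_injective
  map_lab := p.tgt_lab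
  reflect_prec i _ h := absurd h (p.P.T_maximal _ (p.tgt_mem i) _)
  map_evo i j h _ _ := (p.tgt_evo i j).1 h

theorem isFace_comp_terminator (p : IPosetArrow U V) {d : Coface V' V} (hA : d.A = ∅) :
    IsFace (p.comp (terminator d)) d p := by
  let g := compGluing p (terminator d)
  let c : Cocone p (terminator d) p.P :=
    { inl := .refl p.P
      inr := { p.tgtEmbedding with }
      inl_tgt := fun _ => rfl
      mem_T_of_eq := fun x i (h : x = p.tgt i) => h ▸ p.tgt_mem i
      not_prec_inr_inl := fun x i => p.P.T_maximal _ (p.tgt_mem _) _ }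
  obtain ⟨f, hl, hr⟩ := g.exists_desc c
  refine ⟨⟨f, fun x => iff_of_true ⟨_, hl x⟩ (hA ▸ fun _ h => h.elim), fun i => hr _, ?_⟩,
    g.map_prec_of_desc (fun x y h => ?_) (fun _ _ h => h.elim)
      fun _ _ _ h => absurd (Set.mem_univ _) h⟩
  · rw [← g.image_S, Set.image_image]
    simp only [hl]
    exact Set.image_id _
  · rw [hl, hl]
    exact h

theorem IsFace.comp_starter_le {p : IPosetArrow U V} {q : IPosetArrow U V'} {d : Coface V' V}
    (hB : d.B = ∅) (hq : IsFace q d p) : (q.comp (starter d)).P ≤ p.P := by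
  obtain ⟨f, -⟩ := hq
  let g : UpperPart (starter d) d (id V) :=
    { LaxEmbedding.refl (id V).reverse.P with
      mem_range_iff := fun i => iff_of_true ⟨i, rfl⟩ fun j hj =>
        absurd (show j ∈ d.B from hj) (hB ▸ Set.notMem_empty j)
      map_tgt := fun _ => rfl
      image_S := Set.image_id _ }
  calc
    (q.comp (starter d)).P ≤ (p.comp (id V)).P :=
      (compGluing q (starter d)).le (f.laxGluing g (compGluing p (id V)).toLaxGluing)
    _ ≤ p.P := le_of_equiv (comp_id p)

theorem IsFace.comp_starter_equiv {p : IPosetArrow U V} {q : IPosetArrow U V'} {d : Coface V' V}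
    (hB : d.B = ∅) (hq : IsFace q d p)
    (h : ∀ x, x ∉ p.P.T → ∀ i ∈ d.A, p.P.prec x (p.tgt i)) : (q.comp (starter d)).P ≈ p.P := by
  obtain ⟨f, hf⟩ := hq
  have hT : ∀ x j, f.toFun x = p.tgt j → x ∈ q.P.T := fun x j hxj => by
    obtain ⟨i, rfl, -⟩ := f.exists_tgt_eq hxj (hB ▸ Set.notMem_empty j)
    exact q.tgt_mem i
  let g : Gluing q (starter d) p.P :=
    { inl := f.toLaxEmbedding
      inr := { p.tgtEmbedding with }
      inl_tgt := f.map_tgt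
      mem_T_of_eq := hT
      not_prec_inr_inl := fun x i => p.P.T_maximal _ (p.tgt_mem _) _
      cover := fun z => (em (z ∈ Set.range f.toFun)).imp_right fun hz =>
        (f.exists_eq_tgt hz).imp fun _ hi => hi.2.symm
      image_S := f.image_S
      image_T := Set.ext fun z =>
        ⟨by rintro ⟨i, -, rfl⟩; exact p.tgt_mem i,
          fun hz => (p.exists_tgt_eq hz).imp fun _ hi => ⟨trivial, hi⟩⟩
      map_prec_inl := hf
      map_prec_inr := fun _ _ h => h.elim
      prec_inl_inr := fun x j hx hj => by
        refine h _ (fun hfx => ?_) j ?_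
        · obtain ⟨i, hi⟩ := p.exists_tgt_eq hfx
          exact hx (hT x i hi.symm)
        · exact (d.union.ge hj).resolve_right (hB ▸ Set.notMem_empty j) }
  exact (compGluing q (starter d)).equiv g

end IPosetArrow

/-! ### Quotients -/

theorem finite_coface (U : LoSet Act) : Finite (Σ V : LoSet Act, Coface V U) := by
  refine Finite.of_injective (β := Set (Fin U.n) × Set (Fin U.n)) (fun d => (d.2.A, d.2.B)) ?_
  rintro ⟨⟨n, lab⟩, d⟩ ⟨⟨m, lab'⟩, d'⟩ h
  obtain ⟨hA, hB⟩ : d.A = d'.A ∧ d.B = d'.B := Prod.ext_iff.1 h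
  have hr : Set.range d.emb = Set.range d'.emb := by
    rw [← compl_inj_iff, ← d.union, ← d'.union, hA, hB]
  obtain rfl : n = m := by
    simpa only [Set.ncard_range_of_injective d.emb.injective,
      Set.ncard_range_of_injective d'.emb.injective, Nat.card_fin] using congrArg Set.ncard hr
  have he : d.emb = d'.emb := OrderEmbedding.range_inj.1 hr
  obtain rfl : lab = lab' := funext fun i =>
    (d.lab i).symm.trans ((congrArg (fun e => U.lab (e i)) he).trans (d'.lab i))
  congr
  exact Coface.ext he hA hB

/-- A sequence of up- and down-steps between lo-sets, regardless of any automaton. Words are used in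
place of iposets, which form a large type, as the completions of a prefix. -/
inductive Word : LoSet Act → LoSet Act → Type u
  | nil (U : LoSet Act) : Word U U
  | up {U V W : LoSet Act} (d : Coface U V) (hB : d.B = ∅) (w : Word V W) : Word U W
  | down {U V W : LoSet Act} (d : Coface V U) (hA : d.A = ∅) (w : Word V W) : Word U W

namespace Word

/-- The iposet of a word. -/
noncomputable def ev : ∀ {U V : LoSet Act}, Word U V → IPosetArrow U V
  | _, _, .nil U => IPosetArrow.id U
  | _, _, .up d _ w => (starter d).comp w.ev
  | _, _, .down d _ w => (terminator d).comp w.ev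

theorem exists_append {U V W : LoSet Act} (w : Word U V) (w' : Word V W) :
    ∃ r : Word U W, r.ev.P ≈ (w.ev.comp w'.ev).P := by
  induction w with
  | nil U => exact ⟨w', Setoid.symm (id_comp _)⟩
  | up d hB w ih =>
    obtain ⟨r, hr⟩ := ih w'
    exact ⟨.up d hB r, Setoid.trans (comp_congr (Setoid.refl _) hr)
      (Setoid.symm (comp_assoc _ _ _))⟩
  | down d hA w ih =>
    obtain ⟨r, hr⟩ := ih w'
    exact ⟨.down d hA r, Setoid.trans (comp_congr (Setoid.refl _) hr)
      (Setoid.symm (comp_assoc _ _ _))⟩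

end Word

section Quotients

variable (𝓛 : LowerSet (IPoset Act)) {U U' V V' W : LoSet Act}

/-- The quotient of `𝓛` by the prefix `p`, that is the set of its completions. -/
def quot (p : IPosetArrow U V) : Set (Σ W, Word V W) :=
  {w | (p.comp w.2.ev).P ∈ 𝓛}

/-- `𝓛` has finitely many nonempty quotients: finitely many at each lo-set, and only at finitely
many lo-sets. -/
structure FiniteQuotients : Prop where
  finite_range : ∀ V : LoSet Act,
    (Set.range fun p : Σ U, IPosetArrow U V => quot 𝓛 p.2).Finite
  finite_support :
    {V : LoSet Act | ∃ (U : LoSet Act) (p : IPosetArrow U V), (quot 𝓛 p).Nonempty}.Finite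

theorem STAutomaton.finiteQuotients (G : STAutomaton.{u, v} Act) [Finite G.Node]
    (h𝓛 : ∀ P, P ∈ 𝓛 ↔ G.Accepts P) : FiniteQuotients 𝓛 where
  finite_range V := by
    let Φ : Set (Σ z, Coface V (G.ob z)) → Set (Σ W, Word V W) := fun R =>
      {w | ∃ c ∈ R, ∃ y ∈ G.accept, ∃ b, G.Run c.1 y b ∧ Nonempty (UpperPart w.2.ev c.2 b)}
    have (z : G.Node) : Finite (Coface V (G.ob z)) :=
      have := finite_coface (G.ob z)
      Finite.of_injective (Sigma.mk V : _ → Σ V, Coface V (G.ob z)) sigma_mk_injective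
    refine (Set.finite_range Φ).subset ?_
    rintro _ ⟨⟨U, p⟩, rfl⟩
    exact ⟨G.reach p, Set.ext fun w => ((h𝓛 _).trans (G.accepts_comp_iff p w.2.ev)).symm⟩
  finite_support := by
    have (z : G.Node) := finite_coface (G.ob z)
    refine (Set.finite_range fun c : Σ z, Σ V, Coface V (G.ob z) => c.2.1).subset ?_
    rintro V ⟨U, p, w, hw⟩
    obtain ⟨⟨z, d⟩, -⟩ := (G.accepts_comp_iff p w.2.ev).1 ((h𝓛 _).1 hw)
    exact ⟨⟨z, V, d⟩, rfl⟩

variable {𝓛}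

theorem quot_anti {p : IPosetArrow U V} {p' : IPosetArrow U V} (h : p.P ≤ p'.P) :
    quot 𝓛 p' ⊆ quot 𝓛 p :=
  fun _ hw => 𝓛.lower (comp_mono h le_rfl) hw

theorem mem_iff_of_equiv {P Q : IPoset Act} (h : P ≈ Q) : P ∈ 𝓛 ↔ Q ∈ 𝓛 :=
  ⟨𝓛.lower (IPoset.le_of_equiv (Setoid.symm h)), 𝓛.lower (IPoset.le_of_equiv h)⟩

theorem quot_congr {p : IPosetArrow U V} {p' : IPosetArrow U V} (h : p.P ≈ p'.P) :
    quot 𝓛 p = quot 𝓛 p' :=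
  Set.ext fun _ => mem_iff_of_equiv (comp_congr h (Setoid.refl _))

theorem up_mem_quot {p : IPosetArrow U V} {d : Coface V V'} {hB : d.B = ∅} {w : Word V' W} :
    ⟨W, .up d hB w⟩ ∈ quot 𝓛 p ↔ ⟨W, w⟩ ∈ quot 𝓛 (p.comp (starter d)) :=
  (mem_iff_of_equiv (comp_assoc _ _ _)).symm

theorem down_mem_quot {p : IPosetArrow U V} {d : Coface V' V} {hA : d.A = ∅} {w : Word V' W} :
    ⟨W, .down d hA w⟩ ∈ quot 𝓛 p ↔ ⟨W, w⟩ ∈ quot 𝓛 (p.comp (terminator d)) :=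
  (mem_iff_of_equiv (comp_assoc _ _ _)).symm

variable (𝓛)

/-- The quotient by the face of `p` along `d`. Everything is a completion of a face that does not
exist, because it would unstart a source event. -/
def faceQuot (p : IPosetArrow U V) (d : Coface V' V) : Set (Σ W, Word V' W) :=
  {w | ∀ q : IPosetArrow U V', IsFace q d p → w ∈ quot 𝓛 q}

/-- A cell of the quotient automaton over `U`: a family of quotients indexed by the faces of `U`,
with the relations satisfied by the quotients by the faces of a prefix. The field `support` ensures
that there are finitely many cells. -/
@[ext]
structure QuotCell (U : LoSet Act) where
  s : ∀ V : LoSet Act, Coface V U → Set (Σ W, Word V W)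
  support : ∃ V : LoSet Act,
    (∃ (U' : LoSet Act) (p : IPosetArrow U' V), (quot 𝓛 p).Nonempty) ∧ Nonempty (Coface U V)
  values : ∀ (V : LoSet Act) (d : Coface V U),
    s V d ∈ insert Set.univ (Set.range fun p : Σ U, IPosetArrow U V => quot 𝓛 p.2)
  down : ∀ (V W : LoSet Act) (d : Coface V U) (b : Coface W V) (hA : b.A = ∅) (w : Σ Z, Word W Z),
    w ∈ s W (b.comp d) ↔ ⟨w.1, .down b hA w.2⟩ ∈ s V d
  up : ∀ (V W : LoSet Act) (d : Coface V U) (a : Coface W V) (hB : a.B = ∅) (w : Σ Z, Word V Z),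
    w ∈ s V d → ⟨w.1, .up a hB w.2⟩ ∈ s W (a.comp d)

variable {𝓛}

/-- The face of a cell of the quotient automaton. -/
def QuotCell.restrict (f : Coface U V) (c : QuotCell 𝓛 V) : QuotCell 𝓛 U where
  s W d := c.s W (d.comp f)
  support := c.support.imp fun _ hZ => hZ.imp_right fun ⟨d⟩ => ⟨f.comp d⟩
  values W d := c.values W _
  down W Z d b hA w := by
    rw [Coface.assoc]
    exact c.down W Z _ b hA w
  up W Z d a hB w hw := by
    rw [Coface.assoc]
    exact c.up W Z _ a hB w hw

theorem FiniteQuotients.finite_quotCell (h𝓛 : FiniteQuotients 𝓛) :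
    Finite (Σ U : LoSet Act, QuotCell 𝓛 U) := by
  have : Finite _ := h𝓛.finite_support
  have : ∀ U : LoSet Act, Finite (Σ V, Coface V U) := finite_coface
  have (V : LoSet Act) : Finite _ := (h𝓛.finite_range V).insert Set.univ
  let 𝒱 := Set.range fun c : Σ V : {V : LoSet Act | ∃ (U : LoSet Act) (p : IPosetArrow U V),
    (quot 𝓛 p).Nonempty}, Σ U, Coface U V.1 => c.2.1
  have mem_𝒱 (U : LoSet Act) (c : QuotCell 𝓛 U) : U ∈ 𝒱 := by
    obtain ⟨V, hV, ⟨d⟩⟩ := c.support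
    exact ⟨⟨⟨V, hV⟩, U, d⟩, rfl⟩
  refine Finite.of_injective (β := Σ U : 𝒱, ∀ c : Σ V, Coface V U.1,
      ↥(insert Set.univ (Set.range fun p : Σ U, IPosetArrow U c.1 => quot 𝓛 p.2)))
    (fun c => ⟨⟨c.1, mem_𝒱 _ c.2⟩, fun d => ⟨c.2.s d.1 d.2, c.2.values d.1 d.2⟩⟩) ?_
  rintro ⟨U, c⟩ ⟨U', c'⟩ h
  obtain rfl : U = U' := congrArg (fun x => x.1.1) h
  have hs := eq_of_heq (Sigma.mk.inj h).2
  congr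
  ext1
  funext V d
  exact congrArg Subtype.val (congrFun hs ⟨V, d⟩)

theorem faceQuot_comp {p : IPosetArrow U V} {q : IPosetArrow U V'} {d : Coface V' V}
    (hq : IsFace q d p) (b : Coface W V') : faceQuot 𝓛 p (b.comp d) = faceQuot 𝓛 q b :=
  Set.ext fun _ => forall_congr' fun _ => imp_congr_left ⟨fun hr => hr.lift hq, (·.trans hq)⟩

theorem faceQuot_eq_quot {p : IPosetArrow U V} {q : IPosetArrow U V'} {d : Coface V' V}
    (hq : IsFace q d p) : faceQuot 𝓛 p d = quot 𝓛 q :=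
  Set.Subset.antisymm (fun _ hw => hw q hq)
    fun _ hw _ hr => (quot_congr (hr.equiv hq)).ge hw

theorem faceQuot_id (p : IPosetArrow U V) : faceQuot 𝓛 p (Coface.id V) = quot 𝓛 p :=
  faceQuot_eq_quot (isFace_id_iff.2 (Setoid.refl _))

/-- The cell of the quotient automaton reached by the prefix `p`. -/
def cell (p : IPosetArrow U V) (hp : (quot 𝓛 p).Nonempty) : QuotCell 𝓛 V where
  s _ d := faceQuot 𝓛 p d
  support := ⟨V, ⟨U, p, hp⟩, ⟨Coface.id V⟩⟩
  values V' d := by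
    by_cases h : ∃ q, IsFace q d p
    · obtain ⟨q, hq⟩ := h
      exact .inr ⟨⟨U, q⟩, (faceQuot_eq_quot hq).symm⟩
    · exact .inl (Set.eq_univ_of_forall fun _ q hq => absurd ⟨q, hq⟩ h)
  down V' W d b hA w := by
    refine ⟨fun hw q hq => ?_, fun hw r hr => ?_⟩
    · exact down_mem_quot.2 (hw _ ((isFace_comp_terminator q hA).trans hq))
    · obtain ⟨q, hq, hr⟩ := hr.exists_of_comp
      rw [quot_congr (hr.equiv (isFace_comp_terminator q hA))]
      exact down_mem_quot.1 (hw q hq)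
  up V' W d a hB w hw r hr := by
    obtain ⟨q, hq, hr⟩ := hr.exists_of_comp
    exact up_mem_quot.2 (quot_anti (hr.comp_starter_le hB) (hw q hq))

theorem restrict_cell {p : IPosetArrow U V} {q : IPosetArrow U V'} {d : Coface V' V}
    (hq : IsFace q d p) (hp : (quot 𝓛 p).Nonempty) (hq' : (quot 𝓛 q).Nonempty) :
    (cell p hp).restrict d = cell q hq' := by
  ext1
  funext W b
  exact faceQuot_comp hq b

end Quotients

/-! ### The quotient automaton -/

theorem exists_coface (V : LoSet Act) (A B : Set (Fin V.n)) (h : Disjoint A B) :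
    ∃ (V' : LoSet Act) (d : Coface V' V), d.A = A ∧ d.B = B := by
  classical
  let s : Finset (Fin V.n) := ((A ∪ B)ᶜ).toFinset
  let f := s.orderEmbOfFin rfl
  refine ⟨⟨s.card, fun i => V.lab (f i)⟩, ⟨f, A, B, fun i => rfl, h, ?_⟩, rfl, rfl⟩
  rw [Finset.range_orderEmbOfFin, Set.coe_toFinset, compl_compl]

/-- The number of steps in a decomposition of `P` into starters and terminators of single events,
up to the number of source events: each event is started, and terminated unless it is in the target
interface. It is the measure for induction on the last step. -/
noncomputable def IPoset.size (P : IPoset Act) : ℕ :=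
  Nat.card P.carrier + P.Tᶜ.ncard

namespace IPosetArrow

open IPoset

variable {U V V' : LoSet Act} {p : IPosetArrow U V}

theorem IsFace.size_lt {q : IPosetArrow U V'} {d : Coface V' V} (hq : IsFace q d p)
    (hB : d.B = ∅) {i : Fin V.n} (hi : i ∈ d.A) : q.P.size < p.P.size := by
  obtain ⟨f, -⟩ := hq
  have hcard : Nat.card q.P.carrier < Nat.card p.P.carrier := by
    rw [← Set.ncard_range_of_injective f.injective]
    refine Set.ncard_lt_card fun h => ?_
    exact (f.mem_range_iff (p.tgt i)).1 (h ▸ Set.mem_univ _) i hi rfl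
  have hT : q.P.Tᶜ.ncard ≤ p.P.Tᶜ.ncard := by
    refine Set.ncard_le_ncard_of_injOn f.toFun (fun x hx hfx => hx ?_) f.injective.injOn
    obtain ⟨j, hj⟩ := p.exists_tgt_eq hfx
    obtain ⟨k, rfl, -⟩ := f.exists_tgt_eq hj.symm (hB ▸ Set.notMem_empty j)
    exact q.tgt_mem k
  exact add_lt_add_of_lt_of_le hcard hT

theorem exists_comp_starter_equiv (hp : p.P.IsInterval) {i : Fin V.n}
    (hi : (p.tgt i : p.P.carrier) ∉ p.P.S) (h : ∀ x ∉ p.P.T, p.P.prec x (p.tgt i)) :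
    ∃ (V' : LoSet Act) (q : IPosetArrow U V') (d : Coface V' V), d.B = ∅ ∧
      (q.comp (starter d)).P ≈ p.P ∧ q.P.IsInterval ∧ q.P.size < p.P.size := by
  obtain ⟨V', d, hA, hB⟩ := exists_coface V {i} ∅ (Set.disjoint_empty _)
  have hq := p.isFace_face d (by simpa only [hA, Set.mem_singleton_iff, forall_eq])
  refine ⟨V', _, d, hB, hq.comp_starter_equiv hB fun x hx => ?_, hq.isInterval hp,
    hq.size_lt hB (hA.ge rfl)⟩
  simpa only [hA, Set.mem_singleton_iff, forall_eq] using h x hx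

theorem exists_comp_terminator_equiv (hp : p.P.IsInterval) {x : p.P.carrier} (hxT : x ∉ p.P.T)
    (hx : ∀ y, ¬ p.P.prec x y) :
    ∃ (V' : LoSet Act) (q : IPosetArrow U V') (d : Coface V V'), d.A = ∅ ∧
      (q.comp (terminator d)).P ≈ p.P ∧ q.P.IsInterval ∧ q.P.size < p.P.size := by
  let Q : IPoset Act :=
    { p.P with
      T := insert x p.P.T
      T_maximal := Set.forall_mem_insert.2 ⟨hx, p.P.T_maximal⟩ }
  obtain ⟨V', t, ht, ht'⟩ := Q.exists_loSet_T
  let q : IPosetArrow U V' := ⟨Q, p.src, p.src_evo, p.src_lab, t, ht, ht'⟩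
  let f : LaxEmbedding p.P q.P := { LaxEmbedding.refl p.P with }
  obtain ⟨m, hm, hlab⟩ := exists_orderEmbedding_tgt f fun i => Set.mem_insert_of_mem x (p.tgt_mem i)
  let d : Coface V V' :=
    ⟨m, ∅, (Set.range m)ᶜ, hlab, Set.empty_disjoint _, Set.empty_union _⟩
  have hd : IsFace p d q :=
    ⟨{ f with
       mem_range_iff := fun z => iff_of_true ⟨z, rfl⟩ fun _ h => h.elim
       map_tgt := hm
       image_S := Set.image_id _ }, fun _ _ h => h⟩
  have hsize : (insert x p.P.T)ᶜ.ncard < p.P.Tᶜ.ncard :=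
    Set.ncard_lt_ncard (compl_lt_compl_iff_lt.2 (Set.ssubset_insert hxT))
  exact ⟨V', q, d, rfl, (isFace_comp_terminator q rfl).equiv hd, hp,
    Nat.add_lt_add_left hsize (Nat.card p.P.carrier)⟩

theorem id_equiv (hS : p.P.S = Set.univ) (hT : p.P.T = Set.univ) :
    (IPosetArrow.id V).P ≈ p.P := by
  have hsurj : Function.Surjective p.tgtEmbedding := fun x => p.exists_tgt_eq (hT ▸ trivial)
  refine p.tgtEmbedding.equiv_of_surjective hsurj ?_ ?_ fun _ _ h => h.elim
  · exact hS ▸ Set.image_univ_of_surjective hsurj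
  · exact hT ▸ Set.image_univ_of_surjective hsurj

theorem last_step_cases (hp : p.P.IsInterval) :
    (∃ i, (p.tgt i : p.P.carrier) ∉ p.P.S ∧ ∀ x ∉ p.P.T, p.P.prec x (p.tgt i)) ∨
      (∃ x ∉ p.P.T, ∀ y, ¬ p.P.prec x y) ∨ p.P.S = Set.univ ∧ p.P.T = Set.univ := by
  obtain ⟨b, e, hbe, hprec⟩ := hp
  refine or_iff_not_imp_left.2 fun hstart => ?_
  push Not at hstart
  obtain hT | hT := p.P.Tᶜ.eq_empty_or_nonempty
  · rw [Set.compl_empty_iff] at hT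
    refine .inr ⟨Set.eq_univ_of_forall fun x => ?_, hT⟩
    obtain ⟨i, rfl⟩ := p.exists_tgt_eq (x := x) (hT ▸ trivial)
    by_contra hi
    obtain ⟨z, hz, -⟩ := hstart i hi
    exact hz (hT ▸ trivial)
  · -- Let `x` end last among the events outside the target interface. An event after `x` would be
    -- in the target interface and begin after all these ends, so that the first case would apply.
    obtain ⟨x, hx, hmax⟩ := Set.exists_max_image p.P.Tᶜ e (Set.toFinite _) hT
    refine .inl ⟨x, hx, fun y hxy => ?_⟩
    have hey : e x < b y := (hprec x y).1 hxy
    by_cases hy : y ∈ p.P.T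
    · obtain ⟨i, rfl⟩ := p.exists_tgt_eq hy
      obtain ⟨z, hz, hzy⟩ := hstart i fun hS => p.P.S_minimal _ hS _ hxy
      exact hzy ((hprec _ _).2 ((hmax z hz).trans_lt hey))
    · exact (hmax y hy).not_gt (hey.trans_le (hbe y))

end IPosetArrow

theorem IPosetArrow.exists_word {U V : LoSet Act} (p : IPosetArrow U V) (hp : p.P.IsInterval) :
    ∃ w : Word U V, w.ev.P ≈ p.P := by
  obtain ⟨i, hi, h⟩ | ⟨x, hxT, hx⟩ | ⟨hS, hT⟩ := last_step_cases hp
  · obtain ⟨V', q, d, hB, e, hq, _⟩ := exists_comp_starter_equiv hp hi h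
    obtain ⟨w, hw⟩ := q.exists_word hq
    obtain ⟨r, hr⟩ := w.exists_append (.up d hB (.nil V))
    exact ⟨r, Setoid.trans hr (Setoid.trans (comp_congr hw (comp_id _)) e)⟩
  · obtain ⟨V', q, d, hA, e, hq, _⟩ := exists_comp_terminator_equiv hp hxT hx
    obtain ⟨w, hw⟩ := q.exists_word hq
    obtain ⟨r, hr⟩ := w.exists_append (.down d hA (.nil V))
    exact ⟨r, Setoid.trans hr (Setoid.trans (comp_congr hw (comp_id _)) e)⟩
  · have e := id_equiv hS hT
    obtain rfl : V = U := src_eq_of_le (IPoset.le_of_equiv e)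
    exact ⟨.nil V, e⟩
termination_by p.P.size

theorem IPoset.exists_arrow (P : IPoset Act) :
    ∃ (U V : LoSet Act) (p : IPosetArrow U V), p.P = P := by
  obtain ⟨U, s, hs, hs'⟩ := P.exists_loSet_S
  obtain ⟨V, t, ht, ht'⟩ := P.exists_loSet_T
  exact ⟨U, V, ⟨P, s, hs, hs', t, ht, ht'⟩, rfl⟩

section QuotientAutomaton

variable {𝓛 : LowerSet (IPoset Act)}

variable (𝓛) in
/-- The precubical set of cells of the quotient automaton. -/
def quotPrecubical : (LoSet Act)ᵒᵖ ⥤ Type u where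
  obj U := QuotCell 𝓛 U.unop
  map f := TypeCat.ofHom fun c => QuotCell.restrict f.unop c
  map_id U := ConcreteCategory.hom_ext _ _ fun c => QuotCell.ext <| by
    funext V d
    exact congrArg (c.s V) d.comp_id
  map_comp f g := ConcreteCategory.hom_ext _ _ fun c => QuotCell.ext <| by
    funext V d
    exact congrArg (c.s V) (Coface.assoc d g.unop f.unop).symm

variable (𝓛) in
/-- The start cells of the quotient automaton: those whose completions all belong to `𝓛`. -/
def quotStart (U : LoSet Act) : Set (QuotCell 𝓛 U) :=
  {c | c.s U (Coface.id U) ⊆ quot 𝓛 (IPosetArrow.id U)}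

variable (𝓛) in
/-- The accept cells of the quotient automaton: those that the empty word completes. -/
def quotAccept (U : LoSet Act) : Set (QuotCell 𝓛 U) :=
  {c | ⟨U, .nil U⟩ ∈ c.s U (Coface.id U)}

/-- The quotient automaton, whose states are the quotients of `𝓛`: the Myhill–Nerode construction
for higher-dimensional automata. -/
def FiniteQuotients.toHDA (h𝓛 : FiniteQuotients 𝓛) : HDA Act where
  X := quotPrecubical 𝓛
  finite := h𝓛.finite_quotCell
  start := quotStart 𝓛
  accept := quotAccept 𝓛

theorem exists_path_of_mem_quot {U V Z : LoSet Act} (w : Word U V) (p : IPosetArrow Z U)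
    (hw : ⟨V, w⟩ ∈ quot 𝓛 p) : ∃ y ∈ quotAccept 𝓛 V,
      ∃ π : Path (𝟭 (LoSet Act)) (quotPrecubical 𝓛) (U := U) (V := V) (cell p ⟨_, hw⟩) y,
        π.ev = w.ev := by
  induction w with
  | nil U => exact ⟨_, (faceQuot_id p).ge hw, .nil _, rfl⟩
  | up d hB w ih =>
    obtain ⟨y, hy, π, hπ⟩ := ih _ (up_mem_quot.1 hw)
    exact ⟨y, hy, .up d hB (restrict_cell (isFace_comp_starter p hB) _ _) π,
      congrArg (comp (starter d)) hπ⟩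
  | down d hA w ih =>
    obtain ⟨y, hy, π, hπ⟩ := ih _ (down_mem_quot.1 hw)
    exact ⟨y, hy, .down d hA (restrict_cell (isFace_comp_terminator p hA) _ _) π,
      congrArg (comp (terminator d)) hπ⟩

theorem quot_subset_of_path {U V Z : LoSet Act} {x : (quotPrecubical 𝓛).obj (op U)}
    {y : (quotPrecubical 𝓛).obj (op V)} (π : Path (𝟭 (LoSet Act)) (quotPrecubical 𝓛) x y)
    (p : IPosetArrow Z U) (hx : QuotCell.s x U (Coface.id U) ⊆ quot 𝓛 p) :
    QuotCell.s y V (Coface.id V) ⊆ quot 𝓛 (p.comp π.ev) := by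
  induction π with
  | nil x => exact hx.trans (quot_congr (comp_id p)).ge
  | @up U V W x y z d hB hd π ih =>
    refine (ih (p.comp (starter d)) fun w hw => ?_).trans (quot_congr (comp_assoc _ _ _)).le
    have hs : QuotCell.s x U (Coface.id U) = QuotCell.s y U (Coface.comp d (Coface.id V)) := by
      rw [Coface.comp_id, ← Coface.id_comp d, ← hd]
      rfl
    exact up_mem_quot.1 (hx (hs.ge (QuotCell.up y V U (Coface.id V) d hB w hw)))
  | @down U V W x y z d hA hd π ih =>
    refine (ih (p.comp (terminator d)) fun w hw => ?_).trans (quot_congr (comp_assoc _ _ _)).le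
    have hs : QuotCell.s y V (Coface.id V) = QuotCell.s x V (Coface.comp d (Coface.id U)) := by
      rw [Coface.comp_id, ← Coface.id_comp d, ← hd]
      rfl
    exact down_mem_quot.1 (hx ((QuotCell.down x U V (Coface.id U) d hA w).1 (hs.le hw)))

theorem FiniteQuotients.mk_mem_lang_toHDA_iff (h𝓛 : FiniteQuotients 𝓛) (P : IPoset Act) :
    Ipomset.mk P ∈ h𝓛.toHDA.lang ↔ P.IsInterval ∧ P ∈ 𝓛 := by
  constructor
  · rintro ⟨U, V, x, y, π, hx, hy, h⟩
    have e : π.ev.P ≈ P := Setoid.symm (Quotient.exact h)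
    have hπ : (((IPosetArrow.id U).comp π.ev).comp (IPosetArrow.id V)).P ∈ 𝓛 :=
      quot_subset_of_path π _ hx hy
    refine ⟨π.isInterval_ev.of_equiv e, (mem_iff_of_equiv ?_).1 hπ⟩
    exact Setoid.trans (comp_id _) (Setoid.trans (id_comp _) e)
  · rintro ⟨hP, hmem⟩
    obtain ⟨U, V, p, rfl⟩ := P.exists_arrow
    obtain ⟨w, hw⟩ := p.exists_word hP
    have hwq : ⟨V, w⟩ ∈ quot 𝓛 (IPosetArrow.id U) :=
      (mem_iff_of_equiv (Setoid.trans (id_comp _) hw)).2 hmem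
    obtain ⟨y, hy, π, hπ⟩ := exists_path_of_mem_quot w _ hwq
    have e : π.ev.P = w.ev.P := congrArg IPosetArrow.P hπ
    exact ⟨U, V, _, y, π, (faceQuot_id _).le, hy, Quotient.sound (e ▸ Setoid.symm hw)⟩

end QuotientAutomaton

/-! ### Adding interfaces -/

theorem Coface.disjoint_A_image {U V : LoSet Act} (d : Coface U V) (S : Set (Fin U.n)) :
    Disjoint d.A (d.emb '' S) :=
  Set.disjoint_right.2 (Set.forall_mem_image.2 fun j _ => d.emb_notMem_A j)

theorem Coface.disjoint_B_image {U V : LoSet Act} (d : Coface U V) (T : Set (Fin U.n)) :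
    Disjoint d.B (d.emb '' T) :=
  Set.disjoint_right.2 (Set.forall_mem_image.2 fun j _ => d.emb_notMem_B j)

namespace HDA

/-- The automaton with interfaces whose cells are the cells of `H` with arbitrary interfaces. -/
def toIHDA (H : HDA Act) : IHDA Act where
  X := (forgetInterfaces Act).op ⋙ H.X
  finite := by
    have := H.finite
    refine Finite.of_injective (β := Σ c : (Σ U : LoSet Act, H.X.obj (op U)),
      Set (Fin c.1.n) × Set (Fin c.1.n)) (fun c => ⟨⟨c.1.toLoSet, c.2⟩, c.1.S, c.1.T⟩) ?_
    rintro ⟨⟨U, S, T⟩, x⟩ ⟨⟨U', S', T'⟩, x'⟩ h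
    cases h
    rfl
  start U := {x | x ∈ H.start U.toLoSet ∧ U.S = Set.univ}
  accept U := {x | x ∈ H.accept U.toLoSet ∧ U.T = Set.univ}
  start_interface _ _ h := h.2
  accept_interface _ _ h := h.2

variable {H : HDA Act}

theorem exists_path_of_path_toIHDA {U V : ILoSet Act} {x : H.toIHDA.X.obj (op U)}
    {y : H.toIHDA.X.obj (op V)} (p : Path (forgetInterfaces Act) H.toIHDA.X x y) :
    ∃ q : Path (𝟭 (LoSet Act)) H.X (U := U.toLoSet) (V := V.toLoSet) x y, q.ev = p.ev := by
  induction p with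
  | nil x => exact ⟨.nil _, rfl⟩
  | @up U V _ x y z d hB hx p ih =>
    obtain ⟨q, hq⟩ := ih
    exact ⟨.up (F := 𝟭 (LoSet Act)) (U := U.toLoSet) (V := V.toLoSet) d.toCoface hB hx q,
      congrArg (comp (starter d.toCoface)) hq⟩
  | @down U V _ x y z d hA hy p ih =>
    obtain ⟨q, hq⟩ := ih
    exact ⟨.down (F := 𝟭 (LoSet Act)) (U := U.toLoSet) (V := V.toLoSet) d.toCoface hA hy q,
      congrArg (comp (terminator d.toCoface)) hq⟩

/-- Source interfaces are transported forwards along the path, target interfaces backwards. -/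
theorem exists_path_toIHDA {U V : LoSet Act} {x : H.X.obj (op U)} {y : H.X.obj (op V)}
    (p : Path (𝟭 (LoSet Act)) H.X x y) (S : Set (Fin U.n)) (T : Set (Fin V.n)) :
    ∃ (S' : Set (Fin V.n)) (T' : Set (Fin U.n))
      (q : Path (forgetInterfaces Act) H.toIHDA.X (U := ⟨U, S, T'⟩) (V := ⟨V, S', T⟩) x y),
      q.ev = p.ev := by
  induction p with
  | nil x => exact ⟨S, T, .nil _, rfl⟩
  | @up U V _ x y z d hB hx p ih =>
    let e : Coface U V := d
    obtain ⟨S', T', q, hq⟩ := ih (e.emb '' S) T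
    let d' : ICoface (⟨U, S, e.emb ⁻¹' T'⟩ : ILoSet Act) ⟨V, e.emb '' S, T'⟩ :=
      { toCoface := e
        A_S := e.disjoint_A_image S
        B_T := (show e.B = ∅ from hB) ▸ Set.empty_disjoint _
        S_eq := (Set.preimage_image_eq S e.emb.injective).symm
        T_eq := rfl }
    exact ⟨S', _, .up (F := forgetInterfaces Act) d' hB hx q, congrArg (comp (starter e)) hq⟩
  | @down U V _ x y z d hA hy p ih =>
    let e : Coface V U := d
    obtain ⟨S', T', q, hq⟩ := ih (e.emb ⁻¹' S) T
    let d' : ICoface (⟨V, e.emb ⁻¹' S, T'⟩ : ILoSet Act) ⟨U, S, e.emb '' T'⟩ :=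
      { toCoface := e
        A_S := (show e.A = ∅ from hA) ▸ Set.empty_disjoint _
        B_T := e.disjoint_B_image T'
        S_eq := rfl
        T_eq := (Set.preimage_image_eq T' e.emb.injective).symm }
    exact ⟨S', _, .down (F := forgetInterfaces Act) d' hA hy q, congrArg (comp (terminator e)) hq⟩

theorem lang_toIHDA (H : HDA Act) : H.toIHDA.lang = H.lang := by
  ext P
  constructor
  · rintro ⟨U, V, x, y, p, hx, hy, rfl⟩
    obtain ⟨q, hq⟩ := exists_path_of_path_toIHDA p
    exact ⟨U.toLoSet, V.toLoSet, x, y, q, hx.1, hy.1,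
      congrArg (fun a : IPosetArrow U.toLoSet V.toLoSet => Ipomset.mk a.P) hq.symm⟩
  · rintro ⟨U, V, x, y, p, hx, hy, rfl⟩
    obtain ⟨S', T', q, hq⟩ := exists_path_toIHDA p Set.univ Set.univ
    exact ⟨⟨U, Set.univ, T'⟩, ⟨V, S', Set.univ⟩, x, y, q, ⟨hx, rfl⟩, ⟨hy, rfl⟩,
      congrArg (fun a : IPosetArrow U V => Ipomset.mk a.P) hq.symm⟩

end HDA

theorem IpomsetLanguage.RecognisedByHDA.recognisedByIHDA {L : IpomsetLanguage Act}
    (h : L.RecognisedByHDA) : L.RecognisedByIHDA :=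
  h.elim fun H hH => ⟨H.toIHDA, H.lang_toIHDA.trans hH⟩

theorem IpomsetLanguage.recognisedByHDA_kleenePlus {C : Type v} [Category.{w} C]
    (F : C ⥤ LoSet Act) (X : Cᵒᵖ ⥤ Type w') [hX : Finite (Σ U : C, X.obj (op U))]
    (start accept : ∀ U : C, Set (X.obj (op U))) {L : IpomsetLanguage Act}
    (hL : L.carrier = pathLang F X start accept) : L.kleenePlus.RecognisedByHDA := by
  let G := (cellAutomaton F X start accept).loop
  have : Finite G.Node := hX
  let 𝓛 : LowerSet (IPoset Act) :=
    ⟨{P | G.Accepts P}, fun _ _ hPQ ⟨x, hx, y, hy, r, hr, hQ⟩ =>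
      ⟨x, hx, y, hy, r, hr, hPQ.trans hQ⟩⟩
  have h𝓛 : FiniteQuotients 𝓛 := G.finiteQuotients 𝓛 fun _ => Iff.rfl
  refine ⟨h𝓛.toHDA, Set.ext fun P => ?_⟩
  induction P using Quotient.ind with
  | _ P => exact (h𝓛.mk_mem_lang_toHDA_iff P).trans ((cellAutomaton_recognises hL).loop P).symm

end HigherDim

theorem mainTheorem8_general {Act : Type*} (L : HigherDim.IpomsetLanguage Act)
    (hreg : L.RecognisedByHDA ∨ L.RecognisedByIHDA) :
    L.kleenePlus.RecognisedByHDA ∧ L.kleenePlus.RecognisedByIHDA := by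
  have h : L.kleenePlus.RecognisedByHDA := by
    obtain ⟨H, hH⟩ | ⟨H, hH⟩ := hreg
    · have := H.finite
      exact HigherDim.IpomsetLanguage.recognisedByHDA_kleenePlus (𝟭 _) H.X H.start H.accept hH.symm
    · have := H.finite
      exact HigherDim.IpomsetLanguage.recognisedByHDA_kleenePlus (HigherDim.forgetInterfaces Act)
        H.X H.start H.accept hH.symm
  exact ⟨h, h.recognisedByIHDA⟩

/-- A regular language is one that is recognised by an HDA or by an iHDA. If `L` is regular and
separated, then its Kleene plus is regular; indeed it is recognised both by an HDA and by an
iHDA. -/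
theorem mainTheorem8 {Act : Type*} (L : HigherDim.IpomsetLanguage Act)
    (hreg : L.RecognisedByHDA ∨ L.RecognisedByIHDA) (hsep : L.IsSeparated) :
    L.kleenePlus.RecognisedByHDA ∧ L.kleenePlus.RecognisedByIHDA :=
  mainTheorem8_general L hreg
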